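/- Let $(\Omega,\mathcal F,P)$ be an atomless probability space, let $\mu\in\mathbb R$ and $\sigma\ge 0$, and let $V_{SU}(\mu,\sigma)$ be the set of random variables $X$ on $\Omega$ with mean $\mu$ and variance $\sigma^2$ that are symmetric (for some $m$, $X-m$ and $m-X$ have the same law) and unimodal (for some $x_0$, the distribution function $F_X$ is convex on $(-\infty,x_0)$ and concave on $(x_0,\infty)$). Write $\overline F_X(x)=P(X>x)$. Let $g:[0,1]\to\mathbb R$ be of bounded variation with $g(0)=g(1)=0$. Put $\hat g(u)=-g(1-u)$ for $u\in[0,1]$, let $\hat g_*$ be the convex envelope of $\hat g$ on $[0,1]$, that is, the pointwise supremum of all convex functions $h:[0,1]\to\mathbb R$ with $h\le\hat g$, and let $\hat g_*'$ be its right derivative on $(0,1)$. For $b\in[\tfrac12,1)$ let $$\Upsilon(b)=\frac{(b-1)\hat g(1-b)+b\,\hat g(b)+\int_0^{1-b}u\,\mathrm d\hat g(u)+\int_b^1u\,\mathrm d\hat g(u)}{\sqrt{\tfrac23(1-b)^3}}$$ (Riemann--Stieltjes integrals), and let $$\Delta=\frac23\int_0^{1/3}\sqrt u\,\mathrm d\hat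 g_*'(u)+\sqrt3\int_{1/3}^{2/3}(1-u)u\,\mathrm d\hat g_*'(u)+\frac23\int_{2/3}^1\sqrt{1-u}\,\mathrm d\hat g_*'(u)\in[0,\infty],$$ where $\mathrm d\hat g_*'$ is the Lebesgue--Stieltjes measure of $\hat g_*'$ on the open interval $(0,1)$ and the three integrals are over $(0,\tfrac13]$, $(\tfrac13,\tfrac23]$ and $(\tfrac23,1)$. Then $$\sigma\sup_{b\in[\frac12,1)}\Upsilon(b)\;\le\;\sup_{X\in V_{SU}(\mu,\sigma)}\int_{-\infty}^{+\infty}g(\overline F_X(x))\,\mathrm dx,$$ and, if $\hat g_*$ is continuous on $[0,1]$ (i.e. at the end points $0$ and $1$), also $$\sup_{X\in V_{SU}(\mu,\sigma)}\int_{-\infty}^{+\infty}g(\overline F_X(x))\,\mathrm dx\;\le\;\sigma\Delta.$$ The supremum is over those $X\in V_{SU}(\mu,\sigma)$ for which the integral is well defined in $[-\infty,\infty]$, and suprema are taken in $[-\infty,\infty]$, with $0\cdot\infty=0$. -/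

import Mathlib

open MeasureTheory ProbabilityTheory Set
open scoped ENNReal

noncomputable section

/-! ### Symmetric unimodal random variables with given mean and variance -/

/-- The measure `P` is atomless: every measurable set of positive measure has a measurable
subset of strictly smaller positive measure. -/
def IsAtomless {Ω : Type*} [MeasurableSpace Ω] (P : Measure Ω) : Prop :=
  ∀ A : Set Ω, MeasurableSet A → 0 < P A →
    ∃ B : Set Ω, MeasurableSet B ∧ B ⊆ A ∧ 0 < P B ∧ P B < P A

/-- The distribution function `x ↦ P(X ≤ x)`. -/
def distFun {Ω : Type*} [MeasurableSpace Ω] (P : Measure Ω) (X : Ω → ℝ) (x : ℝ) : ℝ :=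
  P.real {ω | X ω ≤ x}

/-- The survival function `x ↦ P(X > x)`. -/
def survFun {Ω : Type*} [MeasurableSpace Ω] (P : Measure Ω) (X : Ω → ℝ) (x : ℝ) : ℝ :=
  P.real {ω | x < X ω}

/-- `X` is unimodal: for some mode `x₀` its distribution function is convex on `(-∞, x₀)` and
concave on `(x₀, ∞)`. -/
def IsUnimodal {Ω : Type*} [MeasurableSpace Ω] (P : Measure Ω) (X : Ω → ℝ) : Prop :=
  ∃ x₀ : ℝ, ConvexOn ℝ (Iio x₀) (distFun P X) ∧ ConcaveOn ℝ (Ioi x₀) (distFun P X)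

/-- `X` is symmetric: for some centre `m`, the variables `X - m` and `m - X` have the same law. -/
def IsSymmetric {Ω : Type*} [MeasurableSpace Ω] (P : Measure Ω) (X : Ω → ℝ) : Prop :=
  ∃ m : ℝ, IdentDistrib (fun ω => X ω - m) (fun ω => m - X ω) P P

/-- The set `V_SU(μ, σ)` of symmetric and unimodal random variables with finite first two moments,
mean `μ` and variance `σ²`. -/
def symmUnimodal {Ω : Type*} [MeasurableSpace Ω] (P : Measure Ω) (μ σ : ℝ) : Set (Ω → ℝ) :=
  {X | Measurable X ∧ MemLp X 2 P ∧ P[X] = μ ∧ Var[X; P] = σ ^ 2 ∧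
    IsSymmetric P X ∧ IsUnimodal P X}

/-! ### The entropy `∫ g(P(X > x)) dx` -/

/-- `∫ g(P(X > x))⁺ dx` -/
def entropyPos {Ω : Type*} [MeasurableSpace Ω] (P : Measure Ω) (g : ℝ → ℝ) (X : Ω → ℝ) : ℝ≥0∞ :=
  ∫⁻ x : ℝ, ENNReal.ofReal (g (survFun P X x))

/-- `∫ g(P(X > x))⁻ dx` -/
def entropyNeg {Ω : Type*} [MeasurableSpace Ω] (P : Measure Ω) (g : ℝ → ℝ) (X : Ω → ℝ) : ℝ≥0∞ :=
  ∫⁻ x : ℝ, ENNReal.ofReal (-g (survFun P X x))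

/-- The integral `∫ g(P(X > x)) dx` is well defined as an extended real number. -/
def EntropyWellDefined {Ω : Type*} [MeasurableSpace Ω] (P : Measure Ω) (g : ℝ → ℝ)
    (X : Ω → ℝ) : Prop :=
  entropyPos P g X ≠ ⊤ ∨ entropyNeg P g X ≠ ⊤

/-- The extended real number `∫ g(P(X > x)) dx`, for those `X` for which it is well defined. -/
def entropy {Ω : Type*} [MeasurableSpace Ω] (P : Measure Ω) (g : ℝ → ℝ) (X : Ω → ℝ) : EReal :=
  (entropyPos P g X : EReal) - (entropyNeg P g X : EReal)

/-- The worst-case entropy over `V_SU(μ, σ)`. -/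
def worstCaseEntropy {Ω : Type*} [MeasurableSpace Ω] (P : Measure Ω) (g : ℝ → ℝ)
    (μ σ : ℝ) : EReal :=
  ⨆ X ∈ {X : Ω → ℝ | X ∈ symmUnimodal P μ σ ∧ EntropyWellDefined P g X}, entropy P g X

/-! ### The lower bound -/

/-- `I` is the Riemann–Stieltjes integral `∫_a^b f dG`, the limit of the sums
`∑ f(ξᵢ) (G(tᵢ₊₁) - G(tᵢ))` over the tagged partitions `a = t₀ ≤ ⋯ ≤ tₙ = b` as the mesh tends
to zero. -/
def HasRSIntegral (f G : ℝ → ℝ) (a b I : ℝ) : Prop :=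
  ∀ ε > 0, ∃ δ > 0, ∀ (n : ℕ) (t ξ : ℕ → ℝ), Monotone t → t 0 = a → t n = b →
    (∀ i < n, ξ i ∈ Icc (t i) (t (i + 1)) ∧ t (i + 1) - t i < δ) →
    |∑ i ∈ Finset.range n, f (ξ i) * (G (t (i + 1)) - G (t i)) - I| < ε

open Classical in
/-- The Riemann–Stieltjes integral `∫_a^b f dG` (`0` if it does not exist; it exists for
continuous `f` and `G` of bounded variation). -/
def rsIntegral (f G : ℝ → ℝ) (a b : ℝ) : ℝ :=
  if h : ∃ I, HasRSIntegral f G a b I then h.choose else 0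

/-- `ĝ(u) = -g(1 - u)` -/
def hat (g : ℝ → ℝ) (u : ℝ) : ℝ := -g (1 - u)

/-- The function `Υ`, for `k = ĝ`. -/
def upsilon (k : ℝ → ℝ) (b : ℝ) : ℝ :=
  ((b - 1) * k (1 - b) + b * k b + rsIntegral (fun u => u) k 0 (1 - b)
    + rsIntegral (fun u => u) k b 1) / √(2 / 3 * (1 - b) ^ 3)

/-! ### The upper bound -/

/-- The convex envelope on `[0, 1]`: the pointwise supremum of the convex functions
`h : [0, 1] → ℝ` with `h ≤ k` on `[0, 1]`. (Only its values on `[0, 1]` are meaningful.) -/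
def convexEnvelope (k : ℝ → ℝ) (u : ℝ) : ℝ :=
  sSup {y | ∃ h : ℝ → ℝ, ConvexOn ℝ (Icc 0 1) h ∧ (∀ v ∈ Icc (0 : ℝ) 1, h v ≤ k v) ∧ y = h u}

theorem convexOn_convexEnvelope (k : ℝ → ℝ) : ConvexOn ℝ (Icc 0 1) (convexEnvelope k) := by
  refine ⟨convex_Icc 0 1, fun x hx y hy a b ha hb hab => ?_⟩
  have bdd : ∀ u ∈ Icc (0 : ℝ) 1, BddAbove {y | ∃ h : ℝ → ℝ, ConvexOn ℝ (Icc 0 1) h ∧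
      (∀ v ∈ Icc (0 : ℝ) 1, h v ≤ k v) ∧ y = h u} := by
    rintro u hu
    exact ⟨k u, by rintro _ ⟨h, _, h2, rfl⟩; exact h2 u hu⟩
  by_cases hne : ∃ h : ℝ → ℝ, ConvexOn ℝ (Icc 0 1) h ∧ ∀ v ∈ Icc (0 : ℝ) 1, h v ≤ k v
  · obtain ⟨h₀, hc₀, hk₀⟩ := hne
    refine csSup_le ⟨_, h₀, hc₀, hk₀, rfl⟩ ?_
    rintro _ ⟨h, hc, hk, rfl⟩
    refine (hc.2 hx hy ha hb hab).trans ?_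
    have h1 : h x ≤ convexEnvelope k x := le_csSup (bdd x hx) ⟨h, hc, hk, rfl⟩
    have h2 : h y ≤ convexEnvelope k y := le_csSup (bdd y hy) ⟨h, hc, hk, rfl⟩
    simp only [smul_eq_mul]
    gcongr
  · have h0 : ∀ u, convexEnvelope k u = 0 := by
      intro u
      have : {y | ∃ h : ℝ → ℝ, ConvexOn ℝ (Icc 0 1) h ∧ (∀ v ∈ Icc (0 : ℝ) 1, h v ≤ k v) ∧
          y = h u} = ∅ := by
        ext y
        simp only [mem_ofPred_eq, mem_empty_iff_false, iff_false]
        rintro ⟨h, hc, hk, _⟩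
        exact hne ⟨h, hc, hk⟩
      rw [convexEnvelope, this, Real.sSup_empty]
    simp [h0]

/-- The right derivative `h'`. -/
def rightDeriv (h : ℝ → ℝ) (x : ℝ) : ℝ := derivWithin h (Ioi x) x

theorem monotone_rightDeriv_sigmoid {h : ℝ → ℝ} (hh : ConvexOn ℝ (Icc 0 1) h) :
    Monotone fun x : ℝ => rightDeriv h (Real.sigmoid x) := by
  intro x y hxy
  refine hh.monotoneOn_rightDeriv ?_ ?_ (Real.sigmoid_le hxy) <;>
  · rw [interior_Icc]
    exact ⟨Real.sigmoid_pos _, Real.sigmoid_lt_one _⟩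

/-- The Lebesgue–Stieltjes measure `dh'` on `(0, 1)` of the right derivative of a convex function
`h` on `[0, 1]`: it is concentrated on `(0, 1)`, and `dh'((x, y]) = h'(y) - h'(x)` for
`0 < x ≤ y < 1`. As `h'` may be unbounded near `0` and `1`, it is built by transport along the
increasing bijection `Real.sigmoid : ℝ → (0, 1)`. -/
def dRightDeriv {h : ℝ → ℝ} (hh : ConvexOn ℝ (Icc 0 1) h) : Measure ℝ :=
  (monotone_rightDeriv_sigmoid hh).stieltjesFunction.measure.map Real.sigmoid

/-- The constant `Δ`, for `k = ĝ`. -/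
def bigDelta (k : ℝ → ℝ) : ℝ≥0∞ :=
  (∫⁻ u in Ioc 0 (1 / 3), ENNReal.ofReal (2 / 3 * √u) ∂dRightDeriv (convexOn_convexEnvelope k))
  + (∫⁻ u in Ioc (1 / 3) (2 / 3), ENNReal.ofReal (√3 * ((1 - u) * u))
      ∂dRightDeriv (convexOn_convexEnvelope k))
  + ∫⁻ u in Ioo (2 / 3) 1, ENNReal.ofReal (2 / 3 * √(1 - u))
      ∂dRightDeriv (convexOn_convexEnvelope k)

end

/-!
**Upper bound.** Let `φ` be the convex envelope of `ĝ`, with `φ ≤ ĝ` and `φ(0), φ(1) ≥ 0`. If `φ`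
is continuous on `[0, 1]`, then `-φ(u) ≤ ∫ (min u v - u v) dφ'(v)`
(`ofReal_neg_le_lintegral_hingeKernel`). As `∫ g(P(X > x)) dx = -∫ ĝ(F(x)) dx ≤ -∫ φ(F(x)) dx`, the
nonnegativity of the kernel and Tonelli's theorem reduce the bound to a single kernel, that is, to
`∫ (min F(x) v - F(x) v) dx ≤ σ w(v)`, where `w` is the integrand of `Δ`.

For a symmetric unimodal `X` with `F` the distribution function of `X - μ` and `H = 1 - F` on
`(0, ∞)`, the left-hand side is `∫₀^∞ min(p, H(x)) dx` with `p = min v (1 - v)`, while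
`σ² = 4 ∫₀^∞ x H(x) dx`; here `H` is convex with values in `[0, 1/2]`. For parameters `a > 0` and
`0 < r ≤ 1/3` put `t = r a`, `λ = 3 (1 - r²) / (2 a)` and `ψ(x) = λ x - 1_{x > t}`. Bounding
`min(p, H)` by `p` on `(0, t]` and by `H` beyond, one has to bound `∫ ψ H` from below. The function
`ψ` changes sign exactly at `t` and `1 / λ`, so that replacing `H` on `(0, a]` by its chord `ℓ`
through these two points decreases the integral, and `ψ` is orthogonal to `x` on `(0, a]`, so that
only `ℓ(0) ≤ 1/2` enters. This gives `lintegral_min_le_of_convexOn`, and optimising over `a` and `r`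
gives the weight `w`.

**Lower bound.** An atomless probability space carries a uniform random variable
(`IsAtomless.exists_uniform`, from Sierpiński's theorem along nested dyadic chains of sets). It
yields, for `b ∈ [1/2, 1)`, a variable with an atom of mass `2 b - 1` at `μ` and the remaining mass
spread uniformly over an interval centred at `μ`. It is symmetric and unimodal, and integration by
parts in the Riemann–Stieltjes integrals shows that its entropy is `σ Υ(b)`.
-/

open Filter Topology

/-! ### The extremal inequality for convex tails -/

/-- The chord of a convex function through two points, as an affine function `A + B x`: it lies
above the function between the two points and below it elsewhere. -/
theorem ConvexOn.exists_chord {s : Set ℝ} {H : ℝ → ℝ} (hc : ConvexOn ℝ s H) {t c : ℝ}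
    (ht : t ∈ s) (hcs : c ∈ s) (htc : t < c) :
    ∃ A B : ℝ, (∀ x ∈ s, x ≤ t → A + B * x ≤ H x) ∧
      (∀ x, t ≤ x → x ≤ c → H x ≤ A + B * x) ∧ (∀ x ∈ s, c ≤ x → A + B * x ≤ H x) := by
  have hd : 0 < c - t := sub_pos.2 htc
  refine ⟨H t - (H c - H t) / (c - t) * t, (H c - H t) / (c - t), ?_, ?_, ?_⟩
  · intro x hx hxt
    rcases hxt.eq_or_lt with rfl | hxt
    · linarith
    have h := hc.slope_mono_adjacent hx hcs hxt htc
    rw [div_le_iff₀ (by linarith)] at h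
    linarith
  · intro x htx hxc
    rcases htx.eq_or_lt with rfl | htx
    · linarith
    rcases hxc.eq_or_lt with rfl | hxc
    · have : (H x - H t) / (x - t) * (x - t) = H x - H t := div_mul_cancel₀ _ hd.ne'
      linarith
    have h := hc.secant_mono_aux2 ht hcs htx hxc
    rw [div_le_iff₀ (by linarith)] at h
    linarith
  · intro x hx hcx
    rcases hcx.eq_or_lt with rfl | hcx
    · have : (H c - H t) / (c - t) * (c - t) = H c - H t := div_mul_cancel₀ _ hd.ne'
      linarith
    have h := hc.secant_mono_aux2 ht hx htc hcx
    rw [le_div_iff₀ (by linarith)] at h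
    linarith

/-- The extremal inequality behind the upper bound, with parameters `a` and `r` still free. The
right-hand side is attained by the tail `(1 - x / a)⁺ / 2` of the uniform law on `[-a, a]` when
`p = (1 - r) / 2`, and, for `r = 1 / 3`, by the tails `(3 p / 2) (1 - x / a)⁺` when `p ≤ 1 / 3`. -/
theorem lintegral_min_le_of_convexOn {H : ℝ → ℝ} (hc : ConvexOn ℝ (Ioi 0) H)
    (h0 : ∀ x, 0 < x → 0 ≤ H x) (h1 : ∀ x, 0 < x → H x ≤ 1 / 2)
    (hint : IntegrableOn (fun x => x * H x) (Ioi 0)) {p a r : ℝ} (hp : 0 ≤ p) (ha : 0 < a)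
    (hr0 : 0 < r) (hr : r ≤ 1 / 3) :
    ∫⁻ x in Ioi 0, ENNReal.ofReal (min p (H x)) ≤
      ENNReal.ofReal (a * p * r + 3 * (1 - r ^ 2) / (2 * a) * (∫ x in Ioi 0, x * H x)
        + a * (1 - r) * (1 - 3 * r) / 8) := by
  set l : ℝ := 3 * (1 - r ^ 2) / (2 * a) with hl
  set t : ℝ := r * a with ht
  have hla : l * a = 3 * (1 - r ^ 2) / 2 := by rw [hl]; field_simp
  have hr2 : r ^ 2 ≤ 1 / 9 := by nlinarith
  have hl0 : 0 < l := by rw [hl]; apply div_pos <;> nlinarith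
  have ht0 : 0 < t := mul_pos hr0 ha
  have hta : t < a := by nlinarith
  have hlt : l * t ≤ 1 / 2 := by
    have : l * t = r * (3 * (1 - r ^ 2) / 2) := by rw [← hla, ht]; ring
    rw [this]; nlinarith
  have htc : t < 1 / l := by rw [lt_div_iff₀ hl0]; linarith
  obtain ⟨A, B, hA1, hA2, hA3⟩ := hc.exists_chord (t := t) (c := 1 / l) ht0
    (by simpa using hl0) htc
  -- The chord lies below `H ≤ 1 / 2` near `0`.
  have hA : A ≤ 1 / 2 := by
    have hlim : Tendsto (fun x : ℝ => A + B * x) (𝓝[>] 0) (𝓝 (A + B * 0)) :=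
      ((continuous_const.add (continuous_const.mul continuous_id)).tendsto 0).mono_left
        nhdsWithin_le_nhds
    rw [mul_zero, add_zero] at hlim
    refine le_of_tendsto hlim ?_
    filter_upwards [Ioc_mem_nhdsGT ht0] with x hx
    exact (hA1 x hx.1 hx.2).trans (h1 x hx.1)
  -- `min p H ≤ l x H + E` pointwise, where `E` vanishes off `(0, a]` and is there a polynomial in
  -- `x` on either side of `t`.
  set E₁ : ℝ → ℝ := fun x => p - l * x * (A + B * x) with hE₁
  set E₂ : ℝ → ℝ := fun x => (1 - l * x) * (A + B * x) with hE₂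
  have i1 : IntegrableOn E₁ (Ioc 0 t) := by
    apply (Continuous.integrableOn_Icc (by fun_prop)).mono_set Ioc_subset_Icc_self
  have i2 : IntegrableOn E₂ (Ioc t a) := by
    apply (Continuous.integrableOn_Icc (by fun_prop)).mono_set Ioc_subset_Icc_self
  have j1 : Integrable ((Ioc 0 t).indicator E₁) (volume.restrict (Ioi 0)) :=
    (i1.integrable_indicator measurableSet_Ioc).integrableOn
  have j2 : Integrable ((Ioc t a).indicator E₂) (volume.restrict (Ioi 0)) :=
    (i2.integrable_indicator measurableSet_Ioc).integrableOn
  have j3 : Integrable (fun x => l * (x * H x)) (volume.restrict (Ioi 0)) := hint.const_mul l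
  set R : ℝ → ℝ := fun x => l * (x * H x) + ((Ioc 0 t).indicator E₁ x + (Ioc t a).indicator E₂ x)
    with hR
  -- On `(t, a]` the factors `l x - 1` and `H x - (A + B x)` have the same sign; beyond `a`, one has
  -- `l x ≥ 1`.
  have key : ∀ x ∈ Ioi (0 : ℝ), min p (H x) ≤ R x := by
    intro x (hx : 0 < x)
    have hH := h0 x hx
    rcases le_or_gt x t with hxt | hxt
    · have e1 : x ∈ Ioc 0 t := ⟨hx, hxt⟩
      have e2 : x ∉ Ioc t a := fun h => absurd h.1 (not_lt.2 hxt)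
      simp only [hR, indicator_of_mem e1, indicator_of_notMem e2, hE₁]
      have := mul_nonneg (mul_nonneg hl0.le hx.le) (sub_nonneg.2 (hA1 x hx hxt))
      have := min_le_left p (H x)
      linarith
    · have e1 : x ∉ Ioc 0 t := fun h => absurd h.2 (not_le.2 hxt)
      have hm := min_le_right p (H x)
      rcases le_or_gt x a with hxa | hxa
      · have e2 : x ∈ Ioc t a := ⟨hxt, hxa⟩
        simp only [hR, indicator_of_notMem e1, indicator_of_mem e2, hE₂]
        rcases le_total x (1 / l) with hxl | hxl
        · have e3 := (le_div_iff₀ hl0).1 hxl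
          have := mul_nonneg (sub_nonneg.2 e3) (sub_nonneg.2 (hA2 x hxt.le hxl))
          linarith
        · have e3 := (div_le_iff₀ hl0).1 hxl
          have := mul_nonneg (sub_nonneg.2 e3) (sub_nonneg.2 (hA3 x hx hxl))
          linarith
      · have e2 : x ∉ Ioc t a := fun h => absurd h.2 (not_le.2 hxa)
        simp only [hR, indicator_of_notMem e1, indicator_of_notMem e2]
        have : 1 ≤ l * x := by nlinarith
        nlinarith
  have hRint : Integrable R (volume.restrict (Ioi 0)) := j3.add (j1.add j2)
  have hnn : ∀ x ∈ Ioi (0 : ℝ), 0 ≤ R x := fun x hx =>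
    (le_min hp (h0 x hx)).trans (key x hx)
  calc ∫⁻ x in Ioi 0, ENNReal.ofReal (min p (H x))
      ≤ ∫⁻ x in Ioi 0, ENNReal.ofReal (R x) :=
        setLIntegral_mono' measurableSet_Ioi fun x hx => ENNReal.ofReal_le_ofReal (key x hx)
    _ = ENNReal.ofReal (∫ x in Ioi 0, R x) :=
        (ofReal_integral_eq_lintegral_ofReal hRint
          (ae_restrict_of_forall_mem measurableSet_Ioi hnn)).symm
    _ ≤ _ := by
        apply ENNReal.ofReal_le_ofReal
        have k1 : ∫ x in Ioi 0, (Ioc 0 t).indicator E₁ x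
            = p * t - l * (A * t ^ 2 / 2 + B * t ^ 3 / 3) := by
          rw [setIntegral_indicator measurableSet_Ioc,
            inter_eq_right.2 (show Ioc 0 t ⊆ Ioi 0 from fun x hx => hx.1),
            ← intervalIntegral.integral_of_le ht0.le,
            intervalIntegral.integral_eq_sub_of_hasDerivAt
              (f := fun x => p * x - l * (A * x ^ 2 / 2 + B * x ^ 3 / 3))]
          · ring
          · intro x _
            have := ((hasDerivAt_id x).const_mul p).sub
              (((((hasDerivAt_id x).pow 2).const_mul A).div_const 2).add
                ((((hasDerivAt_id x).pow 3).const_mul B).div_const 3) |>.const_mul l)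
            convert! this using 1
            simp [hE₁]; ring
          · exact Continuous.intervalIntegrable (by fun_prop) _ _
        have k2 : ∫ x in Ioi 0, (Ioc t a).indicator E₂ x
            = (A * a + B * a ^ 2 / 2 - l * (A * a ^ 2 / 2 + B * a ^ 3 / 3))
              - (A * t + B * t ^ 2 / 2 - l * (A * t ^ 2 / 2 + B * t ^ 3 / 3)) := by
          rw [setIntegral_indicator measurableSet_Ioc,
            inter_eq_right.2 (show Ioc t a ⊆ Ioi 0 from fun x hx => ht0.trans hx.1),
            ← intervalIntegral.integral_of_le hta.le,
            intervalIntegral.integral_eq_sub_of_hasDerivAt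
              (f := fun x => A * x + B * x ^ 2 / 2 - l * (A * x ^ 2 / 2 + B * x ^ 3 / 3))]
          · intro x _
            have := (((hasDerivAt_id x).const_mul A).add
              ((((hasDerivAt_id x).pow 2).const_mul B).div_const 2)).sub
              (((((hasDerivAt_id x).pow 2).const_mul A).div_const 2).add
                ((((hasDerivAt_id x).pow 3).const_mul B).div_const 3) |>.const_mul l)
            convert! this using 1
            simp [hE₂]; ring
          · exact Continuous.intervalIntegrable (by fun_prop) _ _
        have k3 : ∫ x in Ioi 0, R x = l * (∫ x in Ioi 0, x * H x)
            + ((∫ x in Ioi 0, (Ioc 0 t).indicator E₁ x)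
              + ∫ x in Ioi 0, (Ioc t a).indicator E₂ x) := by
          have e := integral_add j3 (j1.add j2)
          have e' := integral_add' j1 j2
          rw [← e', ← integral_const_mul, ← e]
          rfl
        have k4 : p * t - l * (A * t ^ 2 / 2 + B * t ^ 3 / 3)
            + ((A * a + B * a ^ 2 / 2 - l * (A * a ^ 2 / 2 + B * a ^ 3 / 3))
              - (A * t + B * t ^ 2 / 2 - l * (A * t ^ 2 / 2 + B * t ^ 3 / 3)))
            = a * p * r + A * (a * (1 - r) * (1 - 3 * r) / 4) := by
          have e1 : l * (A * a ^ 2 / 2 + B * a ^ 3 / 3)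
            = (l * a) * (A * a / 2 + B * a ^ 2 / 3) := by ring
          rw [e1, hla, ht]; ring
        rw [k3, k1, k2, k4]
        have : 0 ≤ a * (1 - r) * (1 - 3 * r) / 4 := by
          have := mul_nonneg (mul_nonneg ha.le (by linarith : 0 ≤ 1 - r))
            (by linarith : 0 ≤ 1 - 3 * r)
          linarith
        nlinarith

/-- Optimal choice of the parameters for `p ≤ 1 / 3`. The bound itself holds for every `p ≥ 0`. -/
theorem lintegral_min_le_sqrt {H : ℝ → ℝ} (hc : ConvexOn ℝ (Ioi 0) H)
    (h0 : ∀ x, 0 < x → 0 ≤ H x) (h1 : ∀ x, 0 < x → H x ≤ 1 / 2)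
    (hint : IntegrableOn (fun x => x * H x) (Ioi 0)) {σ p : ℝ} (hσ : 0 ≤ σ)
    (hvar : 4 * ∫ x in Ioi 0, x * H x = σ ^ 2) (hp : 0 ≤ p) :
    ∫⁻ x in Ioi 0, ENNReal.ofReal (min p (H x)) ≤ ENNReal.ofReal (σ * (2 / 3 * √p)) := by
  rcases hp.eq_or_lt with rfl | hp
  · refine (setLIntegral_mono' (g := fun _ => 0) measurableSet_Ioi fun x hx => ?_).trans (by simp)
    simp
  have hI : ∫ x in Ioi 0, x * H x = σ ^ 2 / 4 := by linarith
  have hsp := Real.sqrt_pos.2 hp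
  have hpp := Real.sq_sqrt hp.le
  have key : ∀ a, 0 < a → ∫⁻ x in Ioi 0, ENNReal.ofReal (min p (H x)) ≤
      ENNReal.ofReal (a * p / 3 + σ ^ 2 / (3 * a)) := by
    intro a ha
    have := lintegral_min_le_of_convexOn hc h0 h1 hint hp.le ha (r := 1 / 3) (by norm_num) le_rfl
    rw [hI] at this
    convert! this using 2
    field_simp
    ring
  rcases hσ.eq_or_lt with rfl | hσ
  -- The optimal `a = σ / √p` degenerates for `σ = 0`; there the bound follows from `a → 0`.
  · have hlim : Tendsto (fun a : ℝ => ENNReal.ofReal (a * p / 3 + (0 : ℝ) ^ 2 / (3 * a)))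
        (𝓝[>] 0) (𝓝 (ENNReal.ofReal (0 * p / 3))) := by
      refine (ENNReal.continuous_ofReal.tendsto _).comp ?_
      refine Tendsto.mono_left ?_ nhdsWithin_le_nhds
      simp only [ne_eq, OfNat.ofNat_ne_zero, not_false_eq_true, zero_pow, zero_div, add_zero]
      exact Continuous.tendsto (by fun_prop) 0
    refine (ge_of_tendsto hlim ?_).trans (by simp)
    filter_upwards [self_mem_nhdsWithin] with a ha
    exact key a ha
  · convert! key (σ / √p) (by positivity) using 2
    have : σ / √p * p = σ * √p := by
      nth_rewrite 2 [← hpp]; field_simp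
    rw [this]
    field_simp
    ring

/-- Optimal choice of the parameters for `1 / 3 ≤ p ≤ 1 / 2`. -/
theorem lintegral_min_le_mul {H : ℝ → ℝ} (hc : ConvexOn ℝ (Ioi 0) H)
    (h0 : ∀ x, 0 < x → 0 ≤ H x) (h1 : ∀ x, 0 < x → H x ≤ 1 / 2)
    (hint : IntegrableOn (fun x => x * H x) (Ioi 0)) {σ p : ℝ} (hσ : 0 ≤ σ)
    (hvar : 4 * ∫ x in Ioi 0, x * H x = σ ^ 2) (hp : 1 / 3 ≤ p) (hp2 : p ≤ 1 / 2) :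
    ∫⁻ x in Ioi 0, ENNReal.ofReal (min p (H x)) ≤ ENNReal.ofReal (σ * (√3 * ((1 - p) * p))) := by
  have hI : ∫ x in Ioi 0, x * H x = σ ^ 2 / 4 := by linarith
  rcases hσ.eq_or_lt with rfl | hσ
  · refine (lintegral_min_le_sqrt hc h0 h1 hint le_rfl hvar (by linarith)).trans (by simp)
  have h3 : 0 < √(3 : ℝ) := by positivity
  have h33 : √(3 : ℝ) ^ 2 = 3 := Real.sq_sqrt (by norm_num)
  have key : ∀ r, 0 < r → r ≤ 1 / 3 → ∫⁻ x in Ioi 0, ENNReal.ofReal (min p (H x)) ≤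
      ENNReal.ofReal (√3 * σ * (p * r + (1 - r) ^ 2 / 4)) := by
    intro r hr hr3
    have := lintegral_min_le_of_convexOn hc h0 h1 hint (by linarith : 0 ≤ p)
      (by positivity : 0 < √3 * σ) hr hr3
    rw [hI] at this
    convert! this using 2
    have : 3 * (1 - r ^ 2) / (2 * (√3 * σ)) * (σ ^ 2 / 4) = √3 * σ * ((1 - r ^ 2) / 8) := by
      nth_rewrite 1 [← h33]; field_simp; ring
    rw [this]
    ring
  rcases hp2.eq_or_lt with rfl | hp2
  -- For `p = 1 / 2` the optimal `r = 1 - 2 p` vanishes and is only approached.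
  · have hlim : Tendsto (fun r : ℝ => ENNReal.ofReal (√3 * σ * (1 / 2 * r + (1 - r) ^ 2 / 4)))
        (𝓝[>] 0) (𝓝 (ENNReal.ofReal (√3 * σ * (1 / 2 * 0 + (1 - 0) ^ 2 / 4)))) := by
      refine (ENNReal.continuous_ofReal.tendsto _).comp ?_
      refine Tendsto.mono_left ?_ nhdsWithin_le_nhds
      exact Continuous.tendsto (f := fun r : ℝ => √3 * σ * (1 / 2 * r + (1 - r) ^ 2 / 4))
        (by fun_prop) 0
    refine (ge_of_tendsto hlim ?_).trans (le_of_eq ?_)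
    · filter_upwards [Ioc_mem_nhdsGT (by norm_num : (0 : ℝ) < 1 / 3)] with r hr
      exact key r hr.1 hr.2
    · congr 1; ring
  · convert! key (1 - 2 * p) (by linarith) (by linarith) using 2
    ring

/-! ### Tails of symmetric unimodal laws -/

/-- A symmetric unimodal law on `ℝ` is described by its tail `H` on `(0, ∞)`, which is convex there.
The mode may differ from the centre of symmetry: if it is `≤ 0`, the right tail is convex on
`(0, ∞)`, and otherwise the left tail is; the two agree up to the atoms, hence almost everywhere. -/
theorem exists_convex_tail_of_symmetric_unimodal {ν : Measure ℝ} [IsProbabilityMeasure ν]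
    (hs : ν.map Neg.neg = ν)
    (hu : ∃ x₀ : ℝ, ConvexOn ℝ (Iio x₀) (fun x => ν.real (Iic x)) ∧
      ConcaveOn ℝ (Ioi x₀) (fun x => ν.real (Iic x)))
    (h2 : Integrable (fun x => x ^ 2) ν) :
    ∃ H : ℝ → ℝ, ConvexOn ℝ (Ioi 0) H ∧ (∀ x, 0 < x → 0 ≤ H x) ∧ (∀ x, 0 < x → H x ≤ 1 / 2) ∧
      (∀ᵐ x ∂volume.restrict (Ioi 0), ν.real (Iic x) = 1 - H x ∧ ν.real (Iic (-x)) = H x) ∧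
      IntegrableOn (fun x => x * H x) (Ioi 0) ∧ 4 * ∫ x in Ioi 0, x * H x = ∫ x, x ^ 2 ∂ν := by
  have hneg : ∀ x, ν.real (Iic (-x)) = ν.real (Ici x) := by
    intro x
    nth_rewrite 1 [← hs]
    rw [map_measureReal_apply measurable_neg measurableSet_Iic]
    simp
  have hcompl : ∀ x, ν.real (Iic x) = 1 - ν.real (Ioi x) := by
    intro x
    rw [← compl_Iic, measureReal_compl measurableSet_Iic]
    simp
  have hunion : ∀ x, 0 < x →
      ν.real (Iic (-x) ∪ Ici x) = ν.real (Iic (-x)) + ν.real (Ici x) := fun x hx =>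
    measureReal_union (disjoint_left.2 fun y (hy : y ≤ -x) (hy' : x ≤ y) => by linarith)
      measurableSet_Ici
  have hhalf : ∀ x, 0 < x → ν.real (Ici x) ≤ 1 / 2 := by
    intro x hx
    have h1 := hunion x hx
    have h2 : ν.real (Iic (-x) ∪ Ici x) ≤ 1 := measureReal_le_one
    rw [hneg] at h1
    linarith
  have hle : ∀ x, ν.real (Ioi x) ≤ ν.real (Ici x) := fun x => measureReal_mono Ioi_subset_Ici_self
  have hae : ∀ᵐ x ∂(volume : Measure ℝ), ν.real (Ici x) = ν.real (Ioi x) := by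
    filter_upwards [meas_le_ae_eq_meas_lt ν volume (fun x : ℝ => x)] with x hx
    exact congrArg ENNReal.toReal hx
  obtain ⟨H, hc, h0, h1, hH⟩ : ∃ H : ℝ → ℝ, ConvexOn ℝ (Ioi 0) H ∧ (∀ x, 0 < x → 0 ≤ H x) ∧
      (∀ x, 0 < x → H x ≤ 1 / 2) ∧ ∀ᵐ x ∂(volume : Measure ℝ), H x = ν.real (Ioi x) := by
    obtain ⟨x₀, hv, hcv⟩ := hu
    rcases le_total x₀ 0 with hx | hx
    · refine ⟨fun x => ν.real (Ioi x), ?_, fun _ _ => measureReal_nonneg,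
        fun x hx => (hle x).trans (hhalf x hx), ae_of_all _ fun _ => rfl⟩
      have := (convexOn_const (1 : ℝ) (convex_Ioi (0 : ℝ))).sub
        (hcv.subset (Ioi_subset_Ioi hx) (convex_Ioi 0))
      refine this.congr fun x _ => ?_
      simp [hcompl]
    · refine ⟨fun x => ν.real (Ici x), ?_, fun _ _ => measureReal_nonneg, hhalf, hae⟩
      refine ⟨convex_Ioi 0, fun x hx' y hy a b ha hb hab => ?_⟩
      have := hv.2 (x := -x) (y := -y) (lt_of_lt_of_le (neg_lt_zero.2 hx') hx)
        (lt_of_lt_of_le (neg_lt_zero.2 hy) hx) ha hb hab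
      have e : a • -x + b • -y = -(a • x + b • y) := by simp [add_comm]
      simp only [e, hneg] at this
      exact this
  have hHm : AEStronglyMeasurable (fun x => x * H x) (volume.restrict (Ioi 0)) := by
    have hanti : Antitone fun x => ν.real (Ioi x) := fun x y hxy =>
      measureReal_mono (Ioi_subset_Ioi hxy)
    have : AEStronglyMeasurable H volume :=
      hanti.measurable.aestronglyMeasurable.congr (hH.mono fun x hx => hx.symm)
    exact (measurable_id.aestronglyMeasurable.mul this).restrict
  have hnn : 0 ≤ᵐ[volume.restrict (Ioi 0)] fun x => x * H x :=
    ae_restrict_of_forall_mem measurableSet_Ioi fun x hx => mul_nonneg (le_of_lt hx) (h0 x hx)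
  have htail : ∀ᵐ x ∂volume.restrict (Ioi (0 : ℝ)),
      ν.real (Iic x) = 1 - H x ∧ ν.real (Iic (-x)) = H x := by
    filter_upwards [ae_restrict_of_ae hH, ae_restrict_of_ae hae] with x hx hx'
    rw [hneg, hcompl, hx, hx']
    exact ⟨rfl, rfl⟩
  -- The layer cake formula: `∫ x² dν = ∫₀^∞ 2 x ν{|·| ≥ x} dx`, and `ν{|·| ≥ x} = 2 H(x)`.
  have hcake : ∫⁻ x, ENNReal.ofReal (x ^ 2) ∂ν
      = 4 * ∫⁻ x in Ioi 0, ENNReal.ofReal (x * H x) := by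
    have := lintegral_comp_eq_lintegral_meas_le_mul (f := fun x : ℝ => |x|) (g := fun t => 2 * t) ν
      (ae_of_all _ fun x => abs_nonneg x) (by fun_prop)
      (fun t _ => Continuous.intervalIntegrable (by fun_prop) _ _)
      (ae_restrict_of_forall_mem measurableSet_Ioi fun x hx =>
        mul_nonneg zero_le_two (le_of_lt hx))
    have e : ∀ x : ℝ, ∫ t in (0 : ℝ)..|x|, 2 * t = x ^ 2 := by
      intro x
      rw [intervalIntegral.integral_const_mul, integral_id]
      rw [sq_abs]; ring
    simp only [e] at this
    rw [this, ← lintegral_const_mul' _ _ (by simp)]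
    refine lintegral_congr_ae ?_
    filter_upwards [htail, ae_restrict_mem measurableSet_Ioi] with x hx (hx0 : 0 < x)
    have e1 : {a : ℝ | x ≤ |a|} = Iic (-x) ∪ Ici x := by
      ext a
      simp only [mem_ofPred_eq, mem_union, mem_Iic, mem_Ici, le_abs, le_neg (b := a)]
      exact or_comm
    have e0 : ν {a : ℝ | x ≤ |a|} = ENNReal.ofReal (2 * H x) := by
      rw [e1, ← ofReal_measureReal, hunion x hx0, ← hneg, hx.2, two_mul]
    rw [e0, ← ENNReal.ofReal_mul (by linarith [h0 x hx0])]
    rw [show (4 : ℝ≥0∞) = ENNReal.ofReal 4 by simp, ← ENNReal.ofReal_mul (by norm_num)]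
    congr 1; ring
  have hfin : ∫⁻ x in Ioi 0, ENNReal.ofReal (x * H x) ≠ ⊤ := by
    have : ∫⁻ x, ENNReal.ofReal (x ^ 2) ∂ν ≠ ⊤ :=
      ((hasFiniteIntegral_iff_ofReal (ae_of_all _ fun x => sq_nonneg x)).1 h2.2).ne
    intro h
    rw [hcake, h] at this
    simp at this
  have hint : IntegrableOn (fun x => x * H x) (Ioi 0) :=
    ⟨hHm, (hasFiniteIntegral_iff_ofReal hnn).2 (lt_top_iff_ne_top.2 hfin)⟩
  refine ⟨H, hc, h0, h1, htail, hint, ?_⟩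
  rw [integral_eq_lintegral_of_nonneg_ae hnn hHm,
    integral_eq_lintegral_of_nonneg_ae (ae_of_all _ fun x => sq_nonneg x) h2.1, hcake]
  simp

/-- The kernel `min u v - u v`, the Green function of `-d²/du²` on `[0, 1]` with zero boundary
values. -/
noncomputable def hingeKernel (u v : ℝ) : ℝ := min u v - u * v

/-- The integrand of `Δ` on `(0, 1)`: the largest value of `∫ (min F(x) v - F(x) v) dx` over
symmetric unimodal laws of variance `1`. -/
noncomputable def deltaWeight (v : ℝ) : ℝ :=
  if v ≤ 1 / 3 then 2 / 3 * √v else if v ≤ 2 / 3 then √3 * ((1 - v) * v) else 2 / 3 * √(1 - v)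

/-- Splitting the line at the centre of symmetry turns the integral of the kernel into
`∫₀^∞ min (min v (1 - v)) (H x) dx`, where `H` is the tail of the law. -/
theorem lintegral_hingeKernel_le {ν : Measure ℝ} [IsProbabilityMeasure ν]
    (hs : ν.map Neg.neg = ν)
    (hu : ∃ x₀ : ℝ, ConvexOn ℝ (Iio x₀) (fun x => ν.real (Iic x)) ∧
      ConcaveOn ℝ (Ioi x₀) (fun x => ν.real (Iic x)))
    (h2 : Integrable (fun x => x ^ 2) ν) {σ : ℝ} (hσ : 0 ≤ σ) (hvar : ∫ x, x ^ 2 ∂ν = σ ^ 2)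
    {v : ℝ} (hv : v ∈ Ioo (0 : ℝ) 1) :
    ∫⁻ x, ENNReal.ofReal (hingeKernel (ν.real (Iic x)) v) ≤ ENNReal.ofReal (σ * deltaWeight v) := by
  obtain ⟨H, hc, h0, h1, hae, hint, hI⟩ := exists_convex_tail_of_symmetric_unimodal hs hu h2
  rw [hvar] at hI
  have hmono : Monotone fun x => ν.real (Iic x) := fun x y hxy =>
    measureReal_mono (Iic_subset_Iic.2 hxy)
  have hmeas : Measurable fun x => ENNReal.ofReal (hingeKernel (ν.real (Iic x)) v) := by
    unfold hingeKernel
    have := hmono.measurable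
    fun_prop
  have hsplit : ∫⁻ x, ENNReal.ofReal (hingeKernel (ν.real (Iic x)) v)
      = ∫⁻ x in Ioi 0, ENNReal.ofReal (min (min v (1 - v)) (H x)) := by
    have hn : ∫⁻ x in Iic 0, ENNReal.ofReal (hingeKernel (ν.real (Iic x)) v)
        = ∫⁻ x in Ioi 0, ENNReal.ofReal (hingeKernel (ν.real (Iic (-x))) v) := by
      rw [← setLIntegral_congr (Iio_ae_eq_Iic (a := (0 : ℝ))),
        ← (Measure.measurePreserving_neg (volume : Measure ℝ)).setLIntegral_comp_preimage_emb
          (Homeomorph.neg ℝ).measurableEmbedding]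
      congr 2
      simp
    rw [← lintegral_add_compl _ (measurableSet_Iic (a := (0 : ℝ))), compl_Iic, hn,
      ← lintegral_add_right _ hmeas]
    refine lintegral_congr_ae ?_
    filter_upwards [hae, ae_restrict_mem measurableSet_Ioi] with x hx hx0
    rw [hx.1, hx.2]
    have a0 := h0 x hx0
    have a1 := h1 x hx0
    obtain ⟨hv0, hv1⟩ := hv
    rw [← ENNReal.ofReal_add]
    · congr 1
      unfold hingeKernel
      rcases le_total v (1 - v) with h | h
      · rw [min_eq_left h, min_eq_right (a := 1 - H x) (by linarith), min_comm]
        ring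
      · rw [min_eq_right h, min_eq_left (a := H x) (by linarith)]
        rcases le_total (1 - v) (H x) with h' | h'
        · rw [min_eq_left h', min_eq_left (by linarith)]; ring
        · rw [min_eq_right h', min_eq_right (by linarith)]; ring
    all_goals
      unfold hingeKernel
      rw [sub_nonneg, le_min_iff]
      constructor <;> nlinarith
  rw [hsplit]
  unfold deltaWeight
  obtain ⟨hv0, hv1⟩ := hv
  split_ifs with h h'
  · rw [min_eq_left (by linarith : v ≤ 1 - v)]
    exact lintegral_min_le_sqrt hc h0 h1 hint hσ hI hv0.le
  · rcases le_total v (1 - v) with h'' | h''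
    · rw [min_eq_left h'']
      exact lintegral_min_le_mul hc h0 h1 hint hσ hI (by linarith) (by linarith)
    · rw [min_eq_right h'']
      refine (lintegral_min_le_mul hc h0 h1 hint hσ hI (by linarith) (by linarith)).trans
        (le_of_eq ?_)
      congr 1; ring
  · rw [min_eq_right (by linarith : 1 - v ≤ v)]
    exact lintegral_min_le_sqrt hc h0 h1 hint hσ hI (by linarith)

/-! ### Convex functions as mixtures of kernels -/

/-- The inverse of `Real.sigmoid` on `(0, 1)`; arbitrary elsewhere. -/
noncomputable def logit : ℝ → ℝ := Function.invFun Real.sigmoid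

theorem logit_sigmoid (x : ℝ) : logit (Real.sigmoid x) = x :=
  Function.leftInverse_invFun Real.sigmoid_injective x

theorem exists_sigmoid_eq {s : ℝ} (hs : s ∈ Ioo (0 : ℝ) 1) : ∃ x, Real.sigmoid x = s := by
  rw [← Real.range_sigmoid] at hs
  exact hs

/-- The right limit of the right derivative of `h` at a point of `(0, 1)`, in the form in which it
enters the definition of `dRightDeriv`. It agrees almost everywhere with the right derivative, which
is all that is used. -/
noncomputable def rightLimDeriv {h : ℝ → ℝ} (hh : ConvexOn ℝ (Icc 0 1) h) (s : ℝ) : ℝ :=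
  (monotone_rightDeriv_sigmoid hh).stieltjesFunction (logit s)

section
variable {h : ℝ → ℝ} (hh : ConvexOn ℝ (Icc 0 1) h)

theorem measurableEmbedding_real_sigmoid : MeasurableEmbedding Real.sigmoid :=
  continuous_sigmoid.measurableEmbedding Real.sigmoid_injective

theorem dRightDeriv_Ioc {s t : ℝ} (hs : s ∈ Ioo (0 : ℝ) 1) (ht : t ∈ Ioo (0 : ℝ) 1) :
    dRightDeriv hh (Ioc s t) = ENNReal.ofReal (rightLimDeriv hh t - rightLimDeriv hh s) := by
  obtain ⟨x, rfl⟩ := exists_sigmoid_eq hs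
  obtain ⟨y, rfl⟩ := exists_sigmoid_eq ht
  have : Real.sigmoid ⁻¹' Ioc (Real.sigmoid x) (Real.sigmoid y) = Ioc x y := by
    ext z
    simp [Real.sigmoid_lt_iff, Real.sigmoid_le_iff]
  rw [dRightDeriv, measurableEmbedding_real_sigmoid.map_apply, this, StieltjesFunction.measure_Ioc]
  simp [rightLimDeriv, logit_sigmoid]

theorem dRightDeriv_compl_Ioo : dRightDeriv hh (Ioo 0 1)ᶜ = 0 := by
  have : Real.sigmoid ⁻¹' (Ioo 0 1)ᶜ = ∅ := by
    ext z
    simp [Real.sigmoid_pos, Real.sigmoid_lt_one]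
  rw [dRightDeriv, measurableEmbedding_real_sigmoid.map_apply, this, measure_empty]

instance : SFinite (dRightDeriv hh) := by
  unfold dRightDeriv
  infer_instance

theorem rightDeriv_le_rightLimDeriv {s t : ℝ} (hs : s ∈ Ioo (0 : ℝ) 1) (ht : t ∈ Ioo (0 : ℝ) 1)
    (hst : s ≤ t) : rightDeriv h s ≤ rightLimDeriv hh t := by
  obtain ⟨x, rfl⟩ := exists_sigmoid_eq hs
  obtain ⟨y, rfl⟩ := exists_sigmoid_eq ht
  rw [rightLimDeriv, logit_sigmoid, Monotone.stieltjesFunction_eq]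
  exact (monotone_rightDeriv_sigmoid hh).le_rightLim (Real.sigmoid_le_iff.1 hst)

theorem rightLimDeriv_le_rightDeriv {s t : ℝ} (hs : s ∈ Ioo (0 : ℝ) 1) (ht : t ∈ Ioo (0 : ℝ) 1)
    (hst : s < t) : rightLimDeriv hh s ≤ rightDeriv h t := by
  obtain ⟨x, rfl⟩ := exists_sigmoid_eq hs
  obtain ⟨y, rfl⟩ := exists_sigmoid_eq ht
  rw [rightLimDeriv, logit_sigmoid, Monotone.stieltjesFunction_eq]
  exact (monotone_rightDeriv_sigmoid hh).rightLim_le (Real.sigmoid_lt_iff.1 hst)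

theorem ae_rightLimDeriv_eq :
    ∀ᵐ s ∂(volume : Measure ℝ), s ∈ Ioo (0 : ℝ) 1 → rightLimDeriv hh s = rightDeriv h s := by
  have hm := monotone_rightDeriv_sigmoid hh
  have hN : ∀ᵐ s ∂(volume : Measure ℝ), s ∉ Real.sigmoid ''
      {x | ¬ContinuousAt (fun x : ℝ => rightDeriv h (Real.sigmoid x)) x} :=
    (hm.countable_not_continuousAt.image Real.sigmoid).ae_notMem volume
  refine hN.mono fun s hsN hs => ?_
  obtain ⟨x, hxs⟩ := exists_sigmoid_eq hs
  have hx : ContinuousAt (fun x : ℝ => rightDeriv h (Real.sigmoid x)) x :=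
    not_not.1 fun hx => hsN ⟨x, hx, hxs⟩
  have e := hm.continuousWithinAt_Ioi_iff_rightLim_eq.1 hx.continuousWithinAt
  rw [← hxs, rightLimDeriv, logit_sigmoid, Monotone.stieltjesFunction_eq]
  exact e

/-- The fundamental theorem of calculus for a nonnegative right derivative; integrability is
automatic. -/
theorem lintegral_of_hasDeriv_right_nonneg {G G' : ℝ → ℝ} {a b : ℝ} (hab : a ≤ b)
    (hc : ContinuousOn G (Icc a b)) (hd : ∀ x ∈ Ioo a b, HasDerivWithinAt G (G' x) (Ioi x) x)
    (hn : ∀ x ∈ Ioo a b, 0 ≤ G' x) :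
    ∫⁻ x in Ioo a b, ENNReal.ofReal (G' x) = ENNReal.ofReal (G b - G a) := by
  have hi := intervalIntegral.integrableOn_deriv_right_of_nonneg hc hd hn
  rw [← intervalIntegral.integral_eq_sub_of_hasDeriv_right_of_le hab hc hd
    ((intervalIntegrable_iff_integrableOn_Ioc_of_le hab).2 hi),
    intervalIntegral.integral_of_le hab, integral_Ioc_eq_integral_Ioo,
    ofReal_integral_eq_lintegral_ofReal (hi.mono_set Ioo_subset_Ioc_self)
      (ae_restrict_of_forall_mem measurableSet_Ioo hn)]

theorem lintegral_Ioc_id_eq {ρ : Measure ℝ} [SFinite ρ] (u : ℝ) :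
    ∫⁻ v in Ioc 0 u, ENNReal.ofReal v ∂ρ = ∫⁻ s in Ioo 0 u, ρ (Ioc s u) := by
  have hS : MeasurableSet {p : ℝ × ℝ | p.1 < p.2} := measurableSet_lt measurable_fst measurable_snd
  have e := Measure.prod_apply (μ := volume.restrict (Ioo 0 u)) (ν := ρ.restrict (Ioc 0 u)) hS
  rw [Measure.prod_apply_symm hS] at e
  refine Eq.trans ?_ (e.trans ?_)
  · refine setLIntegral_congr_fun measurableSet_Ioc fun v hv => ?_
    have : (fun x : ℝ => (x, v)) ⁻¹' {p : ℝ × ℝ | p.1 < p.2} = Iio v := rfl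
    rw [this, Measure.restrict_apply measurableSet_Iio]
    have : Iio v ∩ Ioo 0 u = Ioo 0 v := by
      ext x
      simp only [mem_inter_iff, mem_Iio, mem_Ioo]
      exact ⟨fun h => ⟨h.2.1, h.1⟩, fun h => ⟨h.2, h.1, h.2.trans_le hv.2⟩⟩
    simp [this]
  · refine setLIntegral_congr_fun measurableSet_Ioo fun s hs => ?_
    have : Prod.mk s ⁻¹' {p : ℝ × ℝ | p.1 < p.2} = Ioi s := rfl
    simp only [this]
    rw [Measure.restrict_apply measurableSet_Ioi]
    congr 1
    ext x
    simp only [mem_inter_iff, mem_Ioi, mem_Ioc]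
    exact ⟨fun h => ⟨h.1, h.2.2⟩, fun h => ⟨h.1, hs.1.trans h.1, h.2⟩⟩

theorem lintegral_Ioo_one_sub_eq {ρ : Measure ℝ} [SFinite ρ] (u : ℝ) :
    ∫⁻ v in Ioo u 1, ENNReal.ofReal (1 - v) ∂ρ = ∫⁻ s in Ioo u 1, ρ (Ioc u s) := by
  have hS : MeasurableSet {p : ℝ × ℝ | p.2 ≤ p.1} := measurableSet_le measurable_snd measurable_fst
  have e := Measure.prod_apply (μ := volume.restrict (Ioo u 1)) (ν := ρ.restrict (Ioo u 1)) hS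
  rw [Measure.prod_apply_symm hS] at e
  refine Eq.trans ?_ (e.trans ?_)
  · refine setLIntegral_congr_fun measurableSet_Ioo fun v hv => ?_
    have : (fun x : ℝ => (x, v)) ⁻¹' {p : ℝ × ℝ | p.2 ≤ p.1} = Ici v := rfl
    rw [this, Measure.restrict_apply measurableSet_Ici]
    have : Ici v ∩ Ioo u 1 = Ico v 1 := by
      ext x
      simp only [mem_inter_iff, mem_Ici, mem_Ioo, mem_Ico]
      exact ⟨fun h => ⟨h.1, h.2.2⟩, fun h => ⟨h.1, hv.1.trans_le h.1, h.2⟩⟩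
    simp [this]
  · refine setLIntegral_congr_fun measurableSet_Ioo fun s hs => ?_
    have : Prod.mk s ⁻¹' {p : ℝ × ℝ | p.2 ≤ p.1} = Iic s := rfl
    simp only [this]
    rw [Measure.restrict_apply measurableSet_Iic]
    congr 1
    ext x
    simp only [mem_inter_iff, mem_Iic, mem_Ioo, mem_Ioc]
    exact ⟨fun h => ⟨h.2.1, h.1⟩, fun h => ⟨h.2, h.1, h.2.trans_lt hs.2⟩⟩

/-- A convex function on `[0, 1]`, continuous up to the end points and nonnegative there, is bounded
below through its second derivative measure, with the Green kernel of the interval. There is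
equality when the function vanishes at the end points. -/
theorem ofReal_neg_le_lintegral_hingeKernel (hc : ContinuousOn h (Icc 0 1)) (h0 : 0 ≤ h 0)
    (h1 : 0 ≤ h 1) {u : ℝ} (hu : u ∈ Icc (0 : ℝ) 1) :
    ENNReal.ofReal (-h u) ≤ ∫⁻ v, ENNReal.ofReal (hingeKernel u v) ∂dRightDeriv hh := by
  rcases hu.1.eq_or_lt with rfl | hu0
  · simp [ENNReal.ofReal_of_nonpos, h0]
  rcases hu.2.eq_or_lt with rfl | hu1
  · simp [ENNReal.ofReal_of_nonpos, h1]
  have hu' : u ∈ Ioo (0 : ℝ) 1 := ⟨hu0, hu1⟩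
  set C := rightLimDeriv hh u with hC
  set ρ := dRightDeriv hh with hρ
  have hd : ∀ x ∈ Ioo (0 : ℝ) 1, HasDerivWithinAt h (rightDeriv h x) (Ioi x) x := fun x hx =>
    hh.hasDerivWithinAt_rightDeriv_of_mem_interior (by rwa [interior_Icc])
  have A : ∫⁻ v in Ioc 0 u, ENNReal.ofReal v ∂ρ = ENNReal.ofReal (C * u - h u + h 0) := by
    have e := lintegral_of_hasDeriv_right_nonneg (G := fun s => C * s - h s)
      (G' := fun s => C - rightDeriv h s) hu0.le
      ((continuousOn_const.mul continuousOn_id).sub (hc.mono (Icc_subset_Icc_right hu1.le)))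
      (fun x hx => by
        have := ((hasDerivWithinAt_id x (Ioi x)).const_mul C).sub (hd x ⟨hx.1, hx.2.trans hu1⟩)
        rwa [mul_one] at this)
      (fun x hx => sub_nonneg.2
        (rightDeriv_le_rightLimDeriv hh ⟨hx.1, hx.2.trans hu1⟩ hu' hx.2.le))
    rw [lintegral_Ioc_id_eq]
    have e' : C * u - h u - (C * 0 - h 0) = C * u - h u + h 0 := by ring
    rw [e'] at e
    rw [← e]
    refine lintegral_congr_ae ?_
    filter_upwards [ae_restrict_of_ae (ae_rightLimDeriv_eq hh), ae_restrict_mem measurableSet_Ioo]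
      with s hs hs'
    have hs1 : s ∈ Ioo (0 : ℝ) 1 := ⟨hs'.1, hs'.2.trans hu1⟩
    rw [hρ, dRightDeriv_Ioc hh hs1 hu', hs hs1]
  have B : ∫⁻ v in Ioo u 1, ENNReal.ofReal (1 - v) ∂ρ
      = ENNReal.ofReal (h 1 - h u - C * (1 - u)) := by
    have e := lintegral_of_hasDeriv_right_nonneg (G := fun s => h s - C * s)
      (G' := fun s => rightDeriv h s - C) hu1.le
      ((hc.mono (Icc_subset_Icc_left hu0.le)).sub (continuousOn_const.mul continuousOn_id))
      (fun x hx => by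
        have := (hd x ⟨hu0.trans hx.1, hx.2⟩).sub ((hasDerivWithinAt_id x (Ioi x)).const_mul C)
        rwa [mul_one] at this)
      (fun x hx => sub_nonneg.2
        (rightLimDeriv_le_rightDeriv hh hu' ⟨hu0.trans hx.1, hx.2⟩ hx.1))
    rw [lintegral_Ioo_one_sub_eq]
    have e' : h 1 - C * 1 - (h u - C * u) = h 1 - h u - C * (1 - u) := by ring
    rw [e'] at e
    rw [← e]
    refine lintegral_congr_ae ?_
    filter_upwards [ae_restrict_of_ae (ae_rightLimDeriv_eq hh), ae_restrict_mem measurableSet_Ioo]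
      with s hs hs'
    have hs1 : s ∈ Ioo (0 : ℝ) 1 := ⟨hu0.trans hs'.1, hs'.2⟩
    rw [hρ, dRightDeriv_Ioc hh hu' hs1, hs hs1]
  calc ENNReal.ofReal (-h u)
      ≤ ENNReal.ofReal ((1 - u) * (C * u - h u + h 0) + u * (h 1 - h u - C * (1 - u))) := by
        apply ENNReal.ofReal_le_ofReal
        nlinarith [mul_nonneg (sub_nonneg.2 hu1.le) h0, mul_nonneg hu0.le h1]
    _ ≤ ENNReal.ofReal (1 - u) * ENNReal.ofReal (C * u - h u + h 0)
        + ENNReal.ofReal u * ENNReal.ofReal (h 1 - h u - C * (1 - u)) := by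
        rw [← ENNReal.ofReal_mul (by linarith), ← ENNReal.ofReal_mul hu0.le]
        exact ENNReal.ofReal_add_le
    _ = (∫⁻ v in Ioc 0 u, ENNReal.ofReal (hingeKernel u v) ∂ρ)
        + ∫⁻ v in Ioo u 1, ENNReal.ofReal (hingeKernel u v) ∂ρ := by
        rw [← A, ← B, ← lintegral_const_mul' _ _ (by simp), ← lintegral_const_mul' _ _ (by simp)]
        congr 1
        · refine setLIntegral_congr_fun measurableSet_Ioc fun v hv => ?_
          rw [← ENNReal.ofReal_mul (by linarith), hingeKernel, min_eq_right hv.2]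
          congr 1; ring
        · refine setLIntegral_congr_fun measurableSet_Ioo fun v hv => ?_
          rw [← ENNReal.ofReal_mul (by linarith), hingeKernel, min_eq_left hv.1.le]
          congr 1; ring
    _ = ∫⁻ v in Ioc 0 u ∪ Ioo u 1, ENNReal.ofReal (hingeKernel u v) ∂ρ :=
        (lintegral_union measurableSet_Ioo
          (disjoint_left.2 fun x hx hx' => absurd hx.2 (not_le.2 hx'.1))).symm
    _ ≤ _ := setLIntegral_le_lintegral _ _

end

theorem bigDelta_eq_lintegral (k : ℝ → ℝ) :
    bigDelta k = ∫⁻ v in Ioo 0 1, ENNReal.ofReal (deltaWeight v)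
      ∂dRightDeriv (convexOn_convexEnvelope k) := by
  have e : Ioo (0 : ℝ) 1 = (Ioc 0 (1 / 3) ∪ Ioc (1 / 3) (2 / 3)) ∪ Ioo (2 / 3) 1 := by
    rw [Ioc_union_Ioc_eq_Ioc (by norm_num) (by norm_num),
      Ioc_union_Ioo_eq_Ioo (by norm_num) (by norm_num)]
  rw [e, lintegral_union measurableSet_Ioo, lintegral_union measurableSet_Ioc, bigDelta]
  · congr 1
    · congr 1
      · refine setLIntegral_congr_fun measurableSet_Ioc fun v hv => ?_
        simp only [deltaWeight, if_pos hv.2]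
      · refine setLIntegral_congr_fun measurableSet_Ioc fun v hv => ?_
        simp only [deltaWeight, if_neg (not_le.2 hv.1), if_pos hv.2]
    · refine setLIntegral_congr_fun measurableSet_Ioo fun v hv => ?_
      have : ¬ v ≤ 1 / 3 := not_le.2 (lt_trans (by norm_num) hv.1)
      simp only [deltaWeight, if_neg this, if_neg (not_le.2 hv.1)]
  · exact disjoint_left.2 fun x hx hx' => absurd hx.2 (not_le.2 hx'.1)
  · refine disjoint_left.2 fun x hx hx' => ?_
    rcases hx with hx | hx
    · have := hx.2; have := hx'.1; linarith
    · exact absurd hx.2 (not_le.2 hx'.1)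

theorem convexEnvelope_le {k : ℝ → ℝ} {M : ℝ} (hM : ∀ v ∈ Icc (0 : ℝ) 1, -M ≤ k v) {u : ℝ}
    (hu : u ∈ Icc (0 : ℝ) 1) : convexEnvelope k u ≤ k u := by
  refine csSup_le ⟨-M, fun _ => -M, convexOn_const _ (convex_Icc 0 1), hM, rfl⟩ ?_
  rintro _ ⟨h, _, hk, rfl⟩
  exact hk u hu

theorem le_convexEnvelope {k f : ℝ → ℝ} (hf : ConvexOn ℝ (Icc 0 1) f)
    (hfk : ∀ v ∈ Icc (0 : ℝ) 1, f v ≤ k v) {u : ℝ} (hu : u ∈ Icc (0 : ℝ) 1) :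
    f u ≤ convexEnvelope k u :=
  le_csSup ⟨k u, by rintro _ ⟨h, _, h2, rfl⟩; exact h2 u hu⟩ ⟨f, hf, hfk, rfl⟩

/-- A constant `-M ≤ 0` may be raised to `0` at an extreme point `e` of `[0, 1]` without destroying
convexity. This is why the convex envelope keeps the end point values of the function. -/
theorem convexOn_ite_extreme {e M : ℝ} (hM : 0 ≤ M)
    (he : ∀ x ∈ Icc (0 : ℝ) 1, ∀ y ∈ Icc (0 : ℝ) 1, ∀ a b : ℝ, 0 < a → 0 < b → a + b = 1 →
      a * x + b * y = e → x = e ∧ y = e) :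
    ConvexOn ℝ (Icc 0 1) fun v : ℝ => if v = e then 0 else -M := by
  refine convexOn_iff_forall_pos.2 ⟨convex_Icc 0 1, fun x hx y hy a b ha hb hab => ?_⟩
  simp only [smul_eq_mul]
  by_cases h : a * x + b * y = e
  · obtain ⟨rfl, rfl⟩ := he x hx y hy a b ha hb hab h
    simp [h]
  · rw [if_neg h]
    have : ∀ z : ℝ, -M ≤ if z = e then 0 else -M := fun z => by split_ifs <;> linarith
    nlinarith [mul_le_mul_of_nonneg_left (this x) ha.le, mul_le_mul_of_nonneg_left (this y) hb.le]

theorem convexEnvelope_nonneg_zero {k : ℝ → ℝ} {M : ℝ} (hM : ∀ v ∈ Icc (0 : ℝ) 1, -M ≤ k v)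
    (hM0 : 0 ≤ M) (h0 : k 0 = 0) : 0 ≤ convexEnvelope k 0 := by
  have := le_convexEnvelope (k := k) (convexOn_ite_extreme (e := 0) hM0 ?_) ?_ (u := 0) (by simp)
  · simpa using this
  · intro x hx y hy a b ha hb _ h
    have h1 := mul_nonneg ha.le hx.1
    have h2 := mul_nonneg hb.le hy.1
    constructor
    · have : a * x = 0 := by linarith
      simpa [ha.ne'] using this
    · have : b * y = 0 := by linarith
      simpa [hb.ne'] using this
  · intro v hv
    split_ifs with h
    · rw [h, h0]
    · exact hM v hv

theorem convexEnvelope_nonneg_one {k : ℝ → ℝ} {M : ℝ} (hM : ∀ v ∈ Icc (0 : ℝ) 1, -M ≤ k v)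
    (hM0 : 0 ≤ M) (h1 : k 1 = 0) : 0 ≤ convexEnvelope k 1 := by
  have := le_convexEnvelope (k := k) (convexOn_ite_extreme (e := 1) hM0 ?_) ?_ (u := 1) (by simp)
  · simpa using this
  · intro x hx y hy a b ha hb hab h
    constructor
    · nlinarith [mul_nonneg ha.le (sub_nonneg.2 hx.2), mul_nonneg hb.le (sub_nonneg.2 hy.2), hx.2]
    · nlinarith [mul_nonneg ha.le (sub_nonneg.2 hx.2), mul_nonneg hb.le (sub_nonneg.2 hy.2), hy.2]
  · intro v hv
    split_ifs with h
    · rw [h, h1]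
    · exact hM v hv

/-! ### The upper bound -/

theorem BoundedVariationOn.exists_abs_le {g : ℝ → ℝ} (hg : BoundedVariationOn g (Icc 0 1)) :
    ∃ M, 0 ≤ M ∧ ∀ u ∈ Icc (0 : ℝ) 1, |g u| ≤ M := by
  refine ⟨(eVariationOn g (Icc 0 1)).toReal + |g 0|, by positivity, fun u hu => ?_⟩
  have h := hg.dist_le hu (y := 0) (by simp)
  rw [Real.dist_eq] at h
  have := abs_sub_abs_le_abs_sub (g u) (g 0)
  linarith

section
variable {Ω : Type*} [MeasurableSpace Ω] {P : Measure Ω} [IsProbabilityMeasure P]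

theorem survFun_eq {X : Ω → ℝ} (hX : Measurable X) (x : ℝ) :
    survFun P X x = 1 - distFun P X x := by
  have : {ω | x < X ω} = {ω | X ω ≤ x}ᶜ := by ext; simp
  rw [survFun, this, measureReal_compl (measurableSet_le hX measurable_const), distFun]
  simp

theorem distFun_mem_Icc (X : Ω → ℝ) (x : ℝ) : distFun P X x ∈ Icc (0 : ℝ) 1 :=
  ⟨measureReal_nonneg, measureReal_le_one⟩

theorem distFun_mono (X : Ω → ℝ) : Monotone (distFun P X) := fun _ _ hxy =>
  measureReal_mono fun _ hω => le_trans hω hxy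

theorem lintegral_hingeKernel_distFun_le {X : Ω → ℝ} {μ σ : ℝ} (hσ : 0 ≤ σ)
    (hX : X ∈ symmUnimodal P μ σ) {v : ℝ} (hv : v ∈ Ioo (0 : ℝ) 1) :
    ∫⁻ x, ENNReal.ofReal (hingeKernel (distFun P X x) v) ≤
      ENNReal.ofReal (σ * deltaWeight v) := by
  obtain ⟨hm, hL, hmean, hvar, ⟨m, hsym⟩, x₀, hcv, hcc⟩ := hX
  have hXi : Integrable X P := hL.integrable (by norm_num)
  -- The centre of symmetry is the mean.
  have hmμ : m = μ := by
    have := hsym.integral_eq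
    rw [integral_sub hXi (integrable_const m), integral_sub (integrable_const m) hXi, hmean] at this
    simp at this
    linarith
  subst hmμ
  have hYm : Measurable fun ω => X ω - m := hm.sub_const m
  set ν := P.map (fun ω => X ω - m) with hν
  have : IsProbabilityMeasure ν := Measure.isProbabilityMeasure_map hYm.aemeasurable
  have hF : ∀ x, ν.real (Iic x) = distFun P X (m + x) := by
    intro x
    rw [hν, map_measureReal_apply hYm measurableSet_Iic, distFun]
    congr 1
    ext ω
    simp [add_comm]
  have hs : ν.map Neg.neg = ν := by
    rw [hν, Measure.map_map measurable_neg hYm, hsym.map_eq]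
    congr 1
    ext ω
    simp
  have hu : ∃ x₀ : ℝ, ConvexOn ℝ (Iio x₀) (fun x => ν.real (Iic x)) ∧
      ConcaveOn ℝ (Ioi x₀) (fun x => ν.real (Iic x)) := by
    refine ⟨x₀ - m, ?_, ?_⟩
    · have := hcv.translate_right m
      convert! this using 1
      · ext x; simp [lt_sub_iff_add_lt']
      · ext x; simp [hF]
    · have := hcc.translate_right m
      convert! this using 1
      · ext x; simp [sub_lt_iff_lt_add']
      · ext x; simp [hF]
  have hsq : AEStronglyMeasurable (fun x : ℝ => x ^ 2) ν := by fun_prop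
  have h2 : Integrable (fun x => x ^ 2) ν := by
    rw [hν, integrable_map_measure hsq hYm.aemeasurable]
    exact (hL.sub (memLp_const m)).integrable_sq
  have hv2 : ∫ x, x ^ 2 ∂ν = σ ^ 2 := by
    rw [hν, integral_map hYm.aemeasurable hsq, ← hvar, variance_eq_integral hm.aemeasurable, hmean]
  have := lintegral_hingeKernel_le hs hu h2 hσ hv2 hv
  simp only [hF] at this
  rwa [lintegral_add_left_eq_self
    (fun x => ENNReal.ofReal (hingeKernel (distFun P X x) v)) m] at this

/-- Fubini's theorem for the kernel representation of the convex envelope. It already bounds the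
positive part of the entropy, so well-definedness plays no role. -/
theorem entropyPos_le {g : ℝ → ℝ} (hg : BoundedVariationOn g (Icc 0 1)) (hg0 : g 0 = 0)
    (hg1 : g 1 = 0) {μ σ : ℝ} (hσ : 0 ≤ σ)
    (hc : ContinuousOn (convexEnvelope (hat g)) (Icc 0 1)) {X : Ω → ℝ}
    (hX : X ∈ symmUnimodal P μ σ) :
    entropyPos P g X ≤ ENNReal.ofReal σ * bigDelta (hat g) := by
  obtain ⟨M, hM0, hM⟩ := hg.exists_abs_le
  have hk : ∀ v ∈ Icc (0 : ℝ) 1, -M ≤ hat g v := fun v hv =>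
    neg_le_neg ((le_abs_self _).trans (hM (1 - v) ⟨by linarith [hv.2], by linarith [hv.1]⟩))
  have e0 := convexEnvelope_nonneg_zero hk hM0 (by simp [hat, hg1])
  have e1 := convexEnvelope_nonneg_one hk hM0 (by simp [hat, hg0])
  have hF := distFun_mem_Icc (P := P) X
  have hFm : Measurable (distFun P X) := (distFun_mono X).measurable
  set ρ := dRightDeriv (convexOn_convexEnvelope (hat g)) with hρ
  calc entropyPos P g X
      ≤ ∫⁻ x, ENNReal.ofReal (-convexEnvelope (hat g) (distFun P X x)) := by
        refine lintegral_mono fun x => ENNReal.ofReal_le_ofReal ?_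
        have h1 := convexEnvelope_le hk (hF x)
        rw [survFun_eq hX.1]
        simp only [hat] at h1
        linarith
    _ ≤ ∫⁻ x, ∫⁻ v, ENNReal.ofReal (hingeKernel (distFun P X x) v) ∂ρ :=
        lintegral_mono fun x => ofReal_neg_le_lintegral_hingeKernel _ hc e0 e1 (hF x)
    _ = ∫⁻ v, (∫⁻ x, ENNReal.ofReal (hingeKernel (distFun P X x) v)) ∂ρ := by
        refine lintegral_lintegral_swap (Measurable.aemeasurable ?_)
        unfold Function.uncurry hingeKernel
        fun_prop
    _ = ∫⁻ v in Ioo 0 1, (∫⁻ x, ENNReal.ofReal (hingeKernel (distFun P X x) v)) ∂ρ := by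
        rw [← lintegral_add_compl _ (measurableSet_Ioo (a := (0 : ℝ)) (b := 1)),
          Measure.restrict_eq_zero.2 (dRightDeriv_compl_Ioo _), lintegral_zero_measure, add_zero]
    _ ≤ ∫⁻ v in Ioo 0 1, ENNReal.ofReal σ * ENNReal.ofReal (deltaWeight v) ∂ρ := by
        refine setLIntegral_mono' measurableSet_Ioo fun v hv => ?_
        rw [← ENNReal.ofReal_mul hσ]
        exact lintegral_hingeKernel_distFun_le hσ hX hv
    _ = ENNReal.ofReal σ * bigDelta (hat g) := by
        rw [lintegral_const_mul' _ _ (by simp), bigDelta_eq_lintegral]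

theorem worstCaseEntropy_le {g : ℝ → ℝ} (hg : BoundedVariationOn g (Icc 0 1)) (hg0 : g 0 = 0)
    (hg1 : g 1 = 0) {μ σ : ℝ} (hσ : 0 ≤ σ)
    (hc : ContinuousOn (convexEnvelope (hat g)) (Icc 0 1)) :
    worstCaseEntropy P g μ σ ≤ (σ : EReal) * (bigDelta (hat g) : EReal) := by
  refine iSup₂_le fun X hX => ?_
  calc entropy P g X ≤ (entropyPos P g X : EReal) - 0 :=
        EReal.sub_le_sub le_rfl (EReal.coe_ennreal_nonneg _)
    _ = (entropyPos P g X : EReal) := sub_zero _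
    _ ≤ ((ENNReal.ofReal σ * bigDelta (hat g) : ℝ≥0∞) : EReal) :=
        EReal.coe_ennreal_le_coe_ennreal_iff.2 (entropyPos_le hg hg0 hg1 hσ hc hX.1)
    _ = _ := by rw [EReal.coe_ennreal_mul, EReal.coe_ennreal_ofReal, max_eq_left hσ]

end

/-! ### Uniform random variables on atomless spaces -/

section
variable {Ω : Type*} [MeasurableSpace Ω] {P : Measure Ω} [IsFiniteMeasure P]

theorem IsAtomless.exists_subset_lt (hP : IsAtomless P) {ε : ℝ} (hε : 0 < ε) {A : Set Ω}
    (hA : MeasurableSet A) (hA0 : 0 < P.real A) :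
    ∃ B, MeasurableSet B ∧ B ⊆ A ∧ 0 < P.real B ∧ P.real B < ε := by
  have half : ∀ A, MeasurableSet A → 0 < P.real A →
      ∃ B, MeasurableSet B ∧ B ⊆ A ∧ 0 < P.real B ∧ P.real B ≤ P.real A / 2 := by
    intro A hA hA0
    obtain ⟨B, hB, hBA, hB0, hlt⟩ := hP A hA (by
      rw [pos_iff_ne_zero]
      intro h
      simp [Measure.real, h] at hA0)
    have hB0' : 0 < P.real B := ENNReal.toReal_pos hB0.ne' (measure_ne_top _ _)
    have hlt' : P.real B < P.real A :=
      (ENNReal.toReal_lt_toReal (measure_ne_top _ _) (measure_ne_top _ _)).2 hlt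
    rcases le_total (P.real B) (P.real A / 2) with h | h
    · exact ⟨B, hB, hBA, hB0', h⟩
    · have e : P.real (A \ B) = P.real A - P.real B := measureReal_sdiff hBA hB
      exact ⟨A \ B, hA.diff hB, sdiff_subset, by linarith, by linarith⟩
  have iter : ∀ n : ℕ, ∃ B, MeasurableSet B ∧ B ⊆ A ∧ 0 < P.real B ∧
      P.real B ≤ P.real A * (1 / 2) ^ n := by
    intro n
    induction n with
    | zero => exact ⟨A, hA, subset_rfl, hA0, by simp⟩
    | succ n ih =>
      obtain ⟨B, hB, hBA, hB0, hle⟩ := ih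
      obtain ⟨C, hC, hCB, hC0, hle'⟩ := half B hB hB0
      refine ⟨C, hC, hCB.trans hBA, hC0, ?_⟩
      rw [pow_succ]
      linarith
  obtain ⟨n, hn⟩ := exists_pow_lt_of_lt_one (div_pos hε hA0) (by norm_num : (1 / 2 : ℝ) < 1)
  obtain ⟨B, hB, hBA, hB0, hle⟩ := iter n
  refine ⟨B, hB, hBA, hB0, hle.trans_lt ?_⟩
  rw [lt_div_iff₀ hA0] at hn
  linarith

/-- Sierpiński's theorem: an atomless finite measure takes all intermediate values. The set is built
greedily, each step adding at least half of what can still be added. -/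
theorem IsAtomless.exists_subset_measureReal_eq (hP : IsAtomless P) {A : Set Ω}
    (hA : MeasurableSet A) {t : ℝ} (ht0 : 0 ≤ t) (ht : t ≤ P.real A) :
    ∃ B, MeasurableSet B ∧ B ⊆ A ∧ P.real B = t := by
  let G := {B : Set Ω // MeasurableSet B ∧ B ⊆ A ∧ P.real B ≤ t}
  have step : ∀ B : G, ∃ B' : G, B.1 ⊆ B'.1 ∧ ∀ D, MeasurableSet D → D ⊆ A → Disjoint B.1 D →
      P.real B.1 + P.real D ≤ t → P.real D ≤ 2 * (P.real B'.1 - P.real B.1) := by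
    rintro ⟨B, hB, hBA, hBt⟩
    set S : Set ℝ := {r | ∃ D, MeasurableSet D ∧ D ⊆ A ∧ Disjoint B D ∧
      P.real B + P.real D ≤ t ∧ P.real D = r} with hS
    have hbdd : BddAbove S := ⟨t, by
      rintro _ ⟨D, _, _, _, h, rfl⟩
      linarith [measureReal_nonneg (μ := P) (s := B)]⟩
    have hne : (0 : ℝ) ∈ S := ⟨∅, MeasurableSet.empty, empty_subset _, disjoint_empty _,
      by simpa using hBt, by simp⟩
    obtain ⟨D, hD, hDA, hdis, hDt, hD2⟩ : ∃ D, MeasurableSet D ∧ D ⊆ A ∧ Disjoint B D ∧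
        P.real B + P.real D ≤ t ∧ sSup S ≤ 2 * P.real D := by
      rcases (le_csSup hbdd hne).eq_or_lt with h | h
      · obtain ⟨D, h1, h2, h3, h4, h5⟩ := hne
        exact ⟨D, h1, h2, h3, h4, by rw [← h, h5]; simp⟩
      · obtain ⟨_, ⟨D, h1, h2, h3, h4, rfl⟩, hlt⟩ :=
          exists_lt_of_lt_csSup ⟨0, hne⟩ (half_lt_self h)
        exact ⟨D, h1, h2, h3, h4, by linarith⟩
    have e : P.real (B ∪ D) = P.real B + P.real D := measureReal_union hdis hD
    refine ⟨⟨B ∪ D, hB.union hD, union_subset hBA hDA, by rw [e]; exact hDt⟩, subset_union_left, ?_⟩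
    intro D' h1 h2 h3 h4
    have := le_csSup hbdd ⟨D', h1, h2, h3, h4, rfl⟩
    simp only [e]
    linarith
  choose f hf hf' using step
  let s : ℕ → G := fun n => f^[n] ⟨∅, MeasurableSet.empty, empty_subset _, by simpa using ht0⟩
  have hs : ∀ n, s (n + 1) = f (s n) := fun n => Function.iterate_succ_apply' f n _
  have hmono : Monotone fun n => (s n).1 := monotone_nat_of_le_succ fun n => by
    rw [hs]
    exact hf _
  have hlim : Tendsto (fun n => P.real (s n).1) atTop (𝓝 (P.real (⋃ n, (s n).1))) :=
    (ENNReal.tendsto_toReal (measure_ne_top _ _)).comp (tendsto_measure_iUnion_atTop hmono)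
  have hUt : P.real (⋃ n, (s n).1) ≤ t := le_of_tendsto' hlim fun n => (s n).2.2.2
  have hU : MeasurableSet (⋃ n, (s n).1) := MeasurableSet.iUnion fun n => (s n).2.1
  have hUA : (⋃ n, (s n).1) ⊆ A := iUnion_subset fun n => (s n).2.2.1
  refine ⟨_, hU, hUA, hUt.eq_of_not_lt fun hlt => ?_⟩
  obtain ⟨D, hD, hDA, hD0, hDlt⟩ := hP.exists_subset_lt (sub_pos.2 hlt) (hA.diff hU) (by
    rw [measureReal_sdiff hUA hU]
    linarith)
  have hle : ∀ n, P.real D ≤ 2 * (P.real (s (n + 1)).1 - P.real (s n).1) := by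
    intro n
    rw [hs]
    refine hf' _ D hD (hDA.trans sdiff_subset) ?_ ?_
    · exact disjoint_left.2 fun ω h1 h2 => (hDA h2).2 (mem_iUnion.2 ⟨n, h1⟩)
    · have : P.real (s n).1 ≤ P.real (⋃ n, (s n).1) :=
        measureReal_mono (subset_iUnion (fun n => (s n).1) n)
      linarith
  have hlim0 := ((hlim.comp (tendsto_add_atTop_nat 1)).sub hlim).const_mul 2
  rw [sub_self, mul_zero] at hlim0
  exact absurd (ge_of_tendsto' hlim0 hle) (not_le.2 hD0)

theorem IsAtomless.exists_between (hP : IsAtomless P) {A B : Set Ω} (hA : MeasurableSet A)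
    (hB : MeasurableSet B) (hAB : A ⊆ B) :
    ∃ C, MeasurableSet C ∧ A ⊆ C ∧ C ⊆ B ∧ P.real C = (P.real A + P.real B) / 2 := by
  have hle : P.real A ≤ P.real B := measureReal_mono hAB
  obtain ⟨D, hD, hDB, hDm⟩ := hP.exists_subset_measureReal_eq (hB.diff hA)
    (t := (P.real B - P.real A) / 2) (by linarith)
    (by rw [measureReal_sdiff hAB hA]; linarith)
  refine ⟨A ∪ D, hA.union hD, subset_union_left, union_subset hAB (hDB.trans sdiff_subset), ?_⟩
  rw [measureReal_union (disjoint_left.2 fun ω h1 h2 => (hDB h2).2 h1) hD, hDm]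
  ring
end

section
variable {Ω : Type*} [MeasurableSpace Ω] {P : Measure Ω} [IsProbabilityMeasure P]

/-- `A 0 ⊆ A 1 ⊆ ⋯` is a chain of measurable sets with `P (A k) = k / 2 ^ n` for `k ≤ 2 ^ n`. -/
structure IsDyadicChain (P : Measure Ω) (n : ℕ) (A : ℕ → Set Ω) : Prop where
  measurableSet : ∀ k, MeasurableSet (A k)
  subset_succ : ∀ k, A k ⊆ A (k + 1)
  measureReal : ∀ k ≤ 2 ^ n, P.real (A k) = k / 2 ^ n

theorem IsDyadicChain.refine (hP : IsAtomless P) {n : ℕ} {A : ℕ → Set Ω}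
    (h : IsDyadicChain P n A) : ∃ B, IsDyadicChain P (n + 1) B ∧ ∀ k, B (2 * k) = A k := by
  choose C hC hAC hCA hCm using fun k =>
    hP.exists_between (h.measurableSet k) (h.measurableSet (k + 1)) (h.subset_succ k)
  set B : ℕ → Set Ω := fun j => if j % 2 = 0 then A (j / 2) else C (j / 2) with hB
  have e0 : ∀ k, B (2 * k) = A k := fun k => by simp [hB]
  have e1 : ∀ k, B (2 * k + 1) = C k := fun k => by
    have : (2 * k + 1) / 2 = k := by omega
    simp [hB, this]
  refine ⟨B, ⟨fun j => ?_, fun j => ?_, fun j hj => ?_⟩, e0⟩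
  all_goals obtain ⟨k, rfl | rfl⟩ := Nat.even_or_odd' j
  · rw [e0]; exact h.measurableSet k
  · rw [e1]; exact hC k
  · rw [e0, e1]; exact hAC k
  · rw [e1, show 2 * k + 1 + 1 = 2 * (k + 1) by ring, e0]; exact hCA k
  · rw [e0, h.measureReal k (by rw [pow_succ] at hj; omega), pow_succ]
    push_cast
    field_simp
  · rw [e1, hCm, h.measureReal k (by rw [pow_succ] at hj; omega),
      h.measureReal (k + 1) (by rw [pow_succ] at hj; omega), pow_succ]
    push_cast
    field_simp
    ring

theorem exists_nested_dyadicChain (hP : IsAtomless P) :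
    ∃ T : ℕ → ℕ → Set Ω, T 0 1 = univ ∧ (∀ n, IsDyadicChain P n (T n)) ∧
      ∀ n k, T (n + 1) (2 * k) = T n k := by
  have h0 : IsDyadicChain P 0 fun k => if k = 0 then ∅ else univ := by
    refine ⟨fun k => ?_, fun k => ?_, fun k hk => ?_⟩
    · split_ifs <;> simp
    · simp
    · rw [pow_zero] at hk
      interval_cases k <;> simp
  choose f hf hf' using fun (n : ℕ) (A : {A : ℕ → Set Ω // IsDyadicChain P n A}) =>
    A.2.refine hP
  let T : ∀ n, {A : ℕ → Set Ω // IsDyadicChain P n A} := fun n =>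
    Nat.rec ⟨_, h0⟩ (fun n A => ⟨f n A, hf n A⟩) n
  exact ⟨fun n => (T n).1, rfl, fun n => (T n).2, fun n k => hf' n (T n) k⟩

/-- An atomless probability space carries a uniform random variable: `U ω` is the infimum of the
dyadic numbers `k / 2 ^ n` for which `ω` lies in the `k`-th set of the `n`-th chain. -/
theorem IsAtomless.exists_uniform (hP : IsAtomless P) :
    ∃ U : Ω → ℝ, Measurable U ∧ P.map U = volume.restrict (Icc 0 1) := by
  obtain ⟨T, hT1, hT, hTT⟩ := exists_nested_dyadicChain hP
  have hshift : ∀ i n k, T (n + i) (2 ^ i * k) = T n k := by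
    intro i
    induction i with
    | zero => simp
    | succ i ih =>
      intro n k
      rw [← ih n k, ← hTT (n + i)]
      congr 1
      ring
  have hmono : ∀ {m j n k : ℕ}, (j : ℝ) / 2 ^ m ≤ k / 2 ^ n → T m j ⊆ T n k := by
    intro m j n k hle
    rw [← hshift n m j, ← hshift m n k, add_comm n m]
    refine monotone_nat_of_le_succ (hT (m + n)).subset_succ ?_
    rw [div_le_div_iff₀ (by positivity) (by positivity)] at hle
    have : j * 2 ^ n ≤ k * 2 ^ m := by exact_mod_cast hle
    linarith
  set V : Ω → Set ℝ := fun ω => {q | ∃ n k : ℕ, k ≤ 2 ^ n ∧ ω ∈ T n k ∧ q = k / 2 ^ n} with hV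
  have h1V : ∀ ω, (1 : ℝ) ∈ V ω := fun ω => ⟨0, 1, by simp, by simp [hT1], by simp⟩
  have hVb : ∀ ω, BddBelow (V ω) := fun ω => ⟨0, by
    rintro _ ⟨n, k, _, _, rfl⟩
    positivity⟩
  set U : Ω → ℝ := fun ω => sInf (V ω) with hU
  have hU0 : ∀ ω, 0 ≤ U ω := fun ω => le_csInf ⟨1, h1V ω⟩ (by
    rintro _ ⟨n, k, _, _, rfl⟩
    positivity)
  have hU1 : ∀ ω, U ω ≤ 1 := fun ω => csInf_le (hVb ω) (h1V ω)
  have hlt : ∀ ω x, U ω < x ↔ ∃ n k : ℕ, k ≤ 2 ^ n ∧ (k : ℝ) / 2 ^ n < x ∧ ω ∈ T n k := by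
    intro ω x
    rw [hU, csInf_lt_iff (hVb ω) ⟨1, h1V ω⟩]
    constructor
    · rintro ⟨_, ⟨n, k, h1, h2, rfl⟩, h3⟩
      exact ⟨n, k, h1, h3, h2⟩
    · rintro ⟨n, k, h1, h2, h3⟩
      exact ⟨_, ⟨n, k, h1, h3, rfl⟩, h2⟩
  have hUm : Measurable U := by
    refine measurable_of_Iio fun x => ?_
    have : U ⁻¹' Iio x = ⋃ n : ℕ, ⋃ k : ℕ, ⋃ _ : k ≤ 2 ^ n ∧ (k : ℝ) / 2 ^ n < x, T n k := by
      ext ω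
      simp only [mem_preimage, mem_Iio, hlt, mem_iUnion, exists_prop, and_assoc]
    rw [this]
    exact MeasurableSet.iUnion fun n => MeasurableSet.iUnion fun k => MeasurableSet.iUnion fun _ =>
      (hT n).measurableSet k
  have hmain : ∀ x, 0 < x → x ≤ 1 → P.real (U ⁻¹' Iio x) = x := by
    intro x hx0 hx1
    have key : ∀ n : ℕ, |P.real (U ⁻¹' Iio x) - x| ≤ (1 / 2) ^ n := by
      intro n
      have h2 : (0 : ℝ) < 2 ^ n := by positivity
      obtain ⟨k, hk⟩ : ∃ k, ⌈x * 2 ^ n⌉₊ = k + 1 :=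
        Nat.exists_eq_succ_of_ne_zero (Nat.ceil_pos.2 (by positivity)).ne'
      have hk1 : x * 2 ^ n ≤ k + 1 := by
        have := Nat.le_ceil (x * 2 ^ n)
        rw [hk] at this
        exact_mod_cast this
      have hk2 : (k : ℝ) < x * 2 ^ n := by
        have := Nat.ceil_lt_add_one (by positivity : 0 ≤ x * 2 ^ n)
        rw [hk] at this
        push_cast at this
        linarith
      have hk3 : k + 1 ≤ 2 ^ n := by
        rw [← hk, Nat.ceil_le]
        push_cast
        nlinarith
      have hup : P.real (U ⁻¹' Iio x) ≤ ((k + 1 : ℕ) : ℝ) / 2 ^ n := by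
        rw [← (hT n).measureReal (k + 1) hk3]
        refine measureReal_mono fun ω hω => ?_
        obtain ⟨m, j, _, h3, h4⟩ := (hlt ω x).1 hω
        refine hmono (h3.le.trans ?_) h4
        rw [le_div_iff₀ h2]
        exact_mod_cast hk1
      have hlow : (k : ℝ) / 2 ^ n ≤ P.real (U ⁻¹' Iio x) := by
        rw [← (hT n).measureReal k (by omega)]
        refine measureReal_mono fun ω hω => ?_
        exact (hlt ω x).2 ⟨n, k, by omega, (div_lt_iff₀ h2).2 hk2, hω⟩
      have e1 : x ≤ (k + 1) / 2 ^ n := (le_div_iff₀ h2).2 hk1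
      have e2 : (k : ℝ) / 2 ^ n < x := (div_lt_iff₀ h2).2 hk2
      have e3 : (k + 1 : ℝ) / 2 ^ n = k / 2 ^ n + (1 / 2) ^ n := by
        rw [add_div, one_div_pow]
      push_cast at hup
      rw [abs_le]
      constructor <;> linarith
    have h0 := ge_of_tendsto' (tendsto_pow_atTop_nhds_zero_of_lt_one (by norm_num : (0 : ℝ) ≤ 1 / 2)
      (by norm_num)) key
    exact sub_eq_zero.1 (abs_eq_zero.1 (le_antisymm h0 (abs_nonneg _)))
  refine ⟨U, hUm, ?_⟩
  have : IsProbabilityMeasure (P.map U) := Measure.isProbabilityMeasure_map hUm.aemeasurable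
  refine Measure.ext_of_Ici _ _ fun x => ?_
  rw [Measure.restrict_apply measurableSet_Ici, Measure.map_apply hUm measurableSet_Ici]
  rcases le_or_gt x 0 with hx | hx
  · rw [inter_eq_right.2 (show Icc 0 1 ⊆ Ici x from fun y hy => hx.trans hy.1),
      show U ⁻¹' Ici x = univ from eq_univ_of_forall fun ω => hx.trans (hU0 ω)]
    simp
  rcases lt_or_ge 1 x with hx1 | hx1
  · rw [show Ici x ∩ Icc 0 1 = ∅ from eq_empty_of_forall_notMem fun y hy =>
        absurd (hy.2.2.trans_lt hx1) (not_lt.2 hy.1),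
      show U ⁻¹' Ici x = ∅ from eq_empty_of_forall_notMem fun ω hω =>
        absurd ((hU1 ω).trans_lt hx1) (not_lt.2 hω)]
    simp
  · have e1 : Ici x ∩ Icc 0 1 = Icc x 1 := by
      ext y
      simp only [mem_inter_iff, mem_Ici, mem_Icc]
      exact ⟨fun h => ⟨h.1, h.2.2⟩, fun h => ⟨h.1, hx.le.trans h.1, h.2⟩⟩
    have e2 : U ⁻¹' Ici x = (U ⁻¹' Iio x)ᶜ := by
      rw [← preimage_compl, compl_Iio]
    rw [e1, Real.volume_Icc, ← ofReal_measureReal, e2,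
      measureReal_compl (hUm measurableSet_Iio), hmain x hx hx1]
    simp

end

/-! ### Riemann–Stieltjes integrals of the identity -/

theorem BoundedVariationOn.intervalIntegrable {G : ℝ → ℝ} {a b : ℝ} (hab : a ≤ b)
    (hG : BoundedVariationOn G (Icc a b)) : IntervalIntegrable G volume a b := by
  obtain ⟨p, q, hp, hq, rfl⟩ := hG.locallyBoundedVariationOn.exists_monotoneOn_sub_monotoneOn
  rw [← uIcc_of_le hab] at hp hq
  exact hp.intervalIntegrable.sub hq.intervalIntegrable

/-- Integration by parts. On a cell of a partition the error is at most the mesh times the variation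
of `G` over the cell. -/
theorem hasRSIntegral_id {G : ℝ → ℝ} {a b : ℝ} (hab : a ≤ b)
    (hG : BoundedVariationOn G (Icc a b)) :
    HasRSIntegral (fun u => u) G a b (b * G b - a * G a - ∫ x in a..b, G x) := by
  have hL := hG.locallyBoundedVariationOn
  set V := variationOnFromTo G (Icc a b) a with hV
  have ha : a ∈ Icc a b := left_mem_Icc.2 hab
  have hb : b ∈ Icc a b := right_mem_Icc.2 hab
  have hGV : ∀ {x y}, x ∈ Icc a b → y ∈ Icc a b → x ≤ y → |G y - G x| ≤ V y - V x :=
    fun hx hy hxy => variationOnFromTo.abs_sub_le_sub_of_le hL ha hx hy hxy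
  have hVm : ∀ {x y}, x ∈ Icc a b → y ∈ Icc a b → x ≤ y → V x ≤ V y := fun hx hy hxy =>
    variationOnFromTo.monotoneOn hL ha hx hy hxy
  have hV0 : 0 ≤ V b - V a := sub_nonneg.2 (hVm ha hb hab)
  intro ε hε
  refine ⟨ε / (V b - V a + 1), by positivity, fun n t ξ ht hta htb hξ => ?_⟩
  set δ := ε / (V b - V a + 1) with hδ
  have htm : ∀ i ≤ n, t i ∈ Icc a b := fun i hi =>
    ⟨hta ▸ ht (Nat.zero_le i), htb ▸ ht hi⟩
  have hint : ∀ {x y}, x ∈ Icc a b → y ∈ Icc a b → x ≤ y → IntervalIntegrable G volume x y :=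
    fun hx hy hxy => (hG.mono (Icc_subset_Icc hx.1 hy.2)).intervalIntegrable hxy
  have hcell : ∀ i ∈ Finset.range n,
      |ξ i * (G (t (i + 1)) - G (t i)) - (t (i + 1) * G (t (i + 1)) - t i * G (t i)
        - ∫ x in t i..t (i + 1), G x)| ≤ δ * (V (t (i + 1)) - V (t i)) := by
    intro i hi
    rw [Finset.mem_range] at hi
    have h0 := htm i hi.le
    have h1 := htm (i + 1) hi
    obtain ⟨⟨hξ0, hξ1⟩, hmesh⟩ := hξ i hi
    have hx : ξ i ∈ Icc a b := ⟨h0.1.trans hξ0, hξ1.trans h1.2⟩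
    have i0 := hint h0 hx hξ0
    have i1 := hint hx h1 hξ1
    set W := V (t (i + 1)) - V (t i) with hW
    have hW0 : 0 ≤ W := sub_nonneg.2 (hVm h0 h1 (hξ0.trans hξ1))
    have b0 : |∫ x in t i..ξ i, (G x - G (t i))| ≤ W * |ξ i - t i| := by
      refine (Real.norm_eq_abs _).symm.le.trans
        (intervalIntegral.norm_integral_le_of_norm_le_const fun x hx' => ?_)
      rw [uIoc_of_le hξ0] at hx'
      have hxm : x ∈ Icc a b := ⟨h0.1.trans hx'.1.le, hx'.2.trans hx.2⟩
      have := hGV h0 hxm hx'.1.le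
      have := hVm hxm h1 (hx'.2.trans hξ1)
      rw [Real.norm_eq_abs]
      linarith
    have b1 : |∫ x in ξ i..t (i + 1), (G x - G (t (i + 1)))| ≤ W * |t (i + 1) - ξ i| := by
      refine (Real.norm_eq_abs _).symm.le.trans
        (intervalIntegral.norm_integral_le_of_norm_le_const fun x hx' => ?_)
      rw [uIoc_of_le hξ1] at hx'
      have hxm : x ∈ Icc a b := ⟨hx.1.trans hx'.1.le, hx'.2.trans h1.2⟩
      have := hGV hxm h1 hx'.2
      have := hVm h0 hxm (hξ0.trans hx'.1.le)
      rw [Real.norm_eq_abs, abs_sub_comm]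
      linarith
    rw [intervalIntegral.integral_sub i0 (by simp), intervalIntegral.integral_const,
      smul_eq_mul, abs_of_nonneg (sub_nonneg.2 hξ0)] at b0
    rw [intervalIntegral.integral_sub i1 (by simp), intervalIntegral.integral_const,
      smul_eq_mul, abs_of_nonneg (sub_nonneg.2 hξ1)] at b1
    rw [← intervalIntegral.integral_add_adjacent_intervals i0 i1]
    have e : ξ i * (G (t (i + 1)) - G (t i)) - (t (i + 1) * G (t (i + 1)) - t i * G (t i)
        - ((∫ x in t i..ξ i, G x) + ∫ x in ξ i..t (i + 1), G x))
        = ((∫ x in t i..ξ i, G x) - (ξ i - t i) * G (t i))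
          + ((∫ x in ξ i..t (i + 1), G x) - (t (i + 1) - ξ i) * G (t (i + 1))) := by ring
    rw [e]
    refine (abs_add_le _ _).trans ((add_le_add b0 b1).trans ?_)
    nlinarith
  have hsum : ∑ i ∈ Finset.range n, (t (i + 1) * G (t (i + 1)) - t i * G (t i)
      - ∫ x in t i..t (i + 1), G x) = b * G b - a * G a - ∫ x in a..b, G x := by
    rw [Finset.sum_sub_distrib, Finset.sum_range_sub (fun i => t i * G (t i)),
      intervalIntegral.sum_integral_adjacent_intervals
        (fun k hk => hint (htm k hk.le) (htm (k + 1) hk) (ht (Nat.le_succ k))), hta, htb]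
  rw [← hsum, ← Finset.sum_sub_distrib]
  refine (Finset.abs_sum_le_sum_abs _ _).trans_lt ((Finset.sum_le_sum hcell).trans_lt ?_)
  rw [← Finset.mul_sum, Finset.sum_range_sub (fun i => V (t i)), hta, htb, hδ,
    div_mul_eq_mul_div, div_lt_iff₀ (by positivity)]
  nlinarith

theorem HasRSIntegral.unique {f G : ℝ → ℝ} {a b I J : ℝ} (hab : a ≤ b)
    (hI : HasRSIntegral f G a b I) (hJ : HasRSIntegral f G a b J) : I = J := by
  refine eq_of_forall_dist_le fun ε hε => ?_
  obtain ⟨δ₁, h1, hI⟩ := hI (ε / 2) (half_pos hε)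
  obtain ⟨δ₂, h2, hJ⟩ := hJ (ε / 2) (half_pos hε)
  obtain ⟨n, hn⟩ := exists_nat_gt ((b - a) / min δ₁ δ₂)
  have hm : 0 < min δ₁ δ₂ := lt_min h1 h2
  have hn0 : (0 : ℝ) < n := lt_of_le_of_lt (div_nonneg (sub_nonneg.2 hab) hm.le) hn
  have hmesh : (b - a) / n < min δ₁ δ₂ := by
    rw [div_lt_iff₀ hm] at hn
    rw [div_lt_iff₀ hn0]
    linarith
  set t : ℕ → ℝ := fun i => a + i * ((b - a) / n) with ht
  have hd : 0 ≤ (b - a) / n := div_nonneg (sub_nonneg.2 hab) hn0.le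
  have hstep : ∀ i, t (i + 1) - t i = (b - a) / n := fun i => by
    simp only [ht]
    push_cast
    ring
  have hmono : Monotone t := monotone_nat_of_le_succ fun i => by linarith [hstep i]
  have ht0 : t 0 = a := by simp [ht]
  have htn : t n = b := by
    simp only [ht]
    field_simp
    ring
  have hξ : ∀ i, t i ∈ Icc (t i) (t (i + 1)) := fun i => ⟨le_rfl, hmono (Nat.le_succ i)⟩
  have e1 := hI n t t hmono ht0 htn fun i _ =>
    ⟨hξ i, by rw [hstep]; exact hmesh.trans_le (min_le_left _ _)⟩
  have e2 := hJ n t t hmono ht0 htn fun i _ =>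
    ⟨hξ i, by rw [hstep]; exact hmesh.trans_le (min_le_right _ _)⟩
  rw [abs_lt] at e1 e2
  rw [Real.dist_eq, abs_le]
  constructor <;> linarith

theorem rsIntegral_id {G : ℝ → ℝ} {a b : ℝ} (hab : a ≤ b) (hG : BoundedVariationOn G (Icc a b)) :
    rsIntegral (fun u => u) G a b = b * G b - a * G a - ∫ x in a..b, G x := by
  have h : ∃ I, HasRSIntegral (fun u => u) G a b I := ⟨_, hasRSIntegral_id hab hG⟩
  rw [rsIntegral, dif_pos h]
  exact h.choose_spec.unique hab (hasRSIntegral_id hab hG)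

theorem BoundedVariationOn.hat {g : ℝ → ℝ} (hg : BoundedVariationOn g (Icc 0 1)) :
    BoundedVariationOn (hat g) (Icc 0 1) := by
  have h1 : BoundedVariationOn (fun u => g (1 - u)) (Icc 0 1) :=
    ne_top_of_le_ne_top hg (eVariationOn.comp_le_of_antitoneOn g (fun u : ℝ => 1 - u)
      (fun x _ y _ hxy => sub_le_sub_left hxy 1)
      (fun x hx => ⟨by linarith [hx.2], by linarith [hx.1]⟩))
  exact (LipschitzWith.id.neg (α := ℝ)).comp_boundedVariationOn h1

/-- Integration by parts turns the numerator of `Υ` into ordinary integrals of `g`. -/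
theorem upsilon_hat {g : ℝ → ℝ} (hg : BoundedVariationOn g (Icc 0 1)) (hg0 : g 0 = 0) {b : ℝ}
    (hb : b ∈ Ico (1 / 2 : ℝ) 1) :
    upsilon (hat g) b
      = ((∫ u in (0 : ℝ)..(1 - b), g u) + ∫ u in b..1, g u) / √(2 / 3 * (1 - b) ^ 3) := by
  obtain ⟨hb0, hb1⟩ := hb
  have h1 := rsIntegral_id (a := 0) (b := 1 - b) (by linarith)
    (hg.hat.mono (Icc_subset_Icc_right (by linarith)))
  have h2 := rsIntegral_id (a := b) (b := 1) hb1.le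
    (hg.hat.mono (Icc_subset_Icc_left (by linarith)))
  have e1 : ∫ x in (0 : ℝ)..(1 - b), hat g x = -∫ u in b..1, g u := by
    simp only [hat, intervalIntegral.integral_neg]
    rw [intervalIntegral.integral_comp_sub_left g 1]
    simp
  have e2 : ∫ x in b..1, hat g x = -∫ u in (0 : ℝ)..(1 - b), g u := by
    simp only [hat, intervalIntegral.integral_neg]
    rw [intervalIntegral.integral_comp_sub_left g 1]
    simp
  have e3 : hat g 1 = 0 := by simp [hat, hg0]
  rw [upsilon, h1, h2, e1, e2, e3]
  congr 1
  ring

/-! ### The uniform law with an atom at its centre -/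

/-- The quantile function, up to a factor, of the law with an atom of mass `1 - 2 p` at `0` and the
remaining mass spread uniformly: slope `1` on `[0, p]` and `[1 - p, 1]`, and `0` in between. -/
noncomputable def uniformWithAtomQuantile (p u : ℝ) : ℝ := min u p + max u (1 - p) - 1

theorem uniformWithAtomQuantile_one_sub (p u : ℝ) :
    uniformWithAtomQuantile p (1 - u) = -uniformWithAtomQuantile p u := by
  unfold uniformWithAtomQuantile
  have h1 : min (1 - u) p = 1 - max u (1 - p) := by
    rw [← min_sub_sub_left, sub_sub_cancel]
  have h2 : max (1 - u) (1 - p) = 1 - min u p := max_sub_sub_left 1 u p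
  rw [h1, h2]
  ring

theorem uniformWithAtomQuantile_le_iff_of_neg {p u z : ℝ} (hp : p ≤ 1 / 2)
    (hz : z < 0) : uniformWithAtomQuantile p u ≤ z ↔ u ≤ p + z := by
  unfold uniformWithAtomQuantile
  rcases le_total u p with h1 | h1
  · rw [min_eq_left h1, max_eq_right (by linarith)]
    constructor <;> intro h <;> linarith
  · rw [min_eq_right h1]
    have := le_max_right u (1 - p)
    constructor <;> intro h <;> linarith

theorem uniformWithAtomQuantile_le_iff_of_nonneg {p u z : ℝ} (hp : p ≤ 1 / 2)
    (hz : 0 ≤ z) : uniformWithAtomQuantile p u ≤ z ↔ u ≤ 1 - p + z := by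
  unfold uniformWithAtomQuantile
  rcases le_total u (1 - p) with h1 | h1
  · rw [max_eq_right h1]
    have := min_le_right u p
    constructor <;> intro h <;> linarith
  · rw [max_eq_left h1, min_eq_right (by linarith)]
    constructor <;> intro h <;> linarith

theorem continuous_uniformWithAtomQuantile (p : ℝ) : Continuous (uniformWithAtomQuantile p) := by
  unfold uniformWithAtomQuantile
  fun_prop

theorem integral_uniformWithAtomQuantile_sq {p : ℝ} (hp0 : 0 ≤ p) (hp : p ≤ 1 / 2) :
    ∫ u in (0 : ℝ)..1, uniformWithAtomQuantile p u ^ 2 = 2 / 3 * p ^ 3 := by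
  have hi : ∀ a b, IntervalIntegrable (fun u => uniformWithAtomQuantile p u ^ 2) volume a b :=
    fun a b => ((continuous_uniformWithAtomQuantile p).pow 2).intervalIntegrable a b
  have e1 : ∫ u in (0 : ℝ)..p, uniformWithAtomQuantile p u ^ 2 = p ^ 3 / 3 := by
    rw [intervalIntegral.integral_congr (g := fun u => (u - p) ^ 2) fun u hu => ?_,
      intervalIntegral.integral_comp_sub_right (fun u => u ^ 2), integral_pow]
    · norm_num
      ring
    · rw [uIcc_of_le hp0] at hu
      simp only [uniformWithAtomQuantile]
      rw [min_eq_left hu.2, max_eq_right (by linarith [hu.2])]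
      ring
  have e2 : ∫ u in p..(1 - p), uniformWithAtomQuantile p u ^ 2 = 0 := by
    rw [intervalIntegral.integral_congr (g := fun _ => (0 : ℝ)) fun u hu => ?_]
    · simp
    · rw [uIcc_of_le (by linarith)] at hu
      simp only [uniformWithAtomQuantile]
      rw [min_eq_right hu.1, max_eq_right hu.2]
      ring
  have e3 : ∫ u in (1 - p)..1, uniformWithAtomQuantile p u ^ 2 = p ^ 3 / 3 := by
    rw [intervalIntegral.integral_congr (g := fun u => (u - (1 - p)) ^ 2) fun u hu => ?_,
      intervalIntegral.integral_comp_sub_right (fun u => u ^ 2), integral_pow]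
    · norm_num
    · rw [uIcc_of_le (by linarith)] at hu
      simp only [uniformWithAtomQuantile]
      rw [min_eq_right (by linarith [hu.1]), max_eq_left hu.1]
      ring
  rw [← intervalIntegral.integral_add_adjacent_intervals (hi 0 p) (hi p 1),
    ← intervalIntegral.integral_add_adjacent_intervals (hi p (1 - p)) (hi (1 - p) 1), e1, e2, e3]
  ring

section
variable {Ω : Type*} [MeasurableSpace Ω] {P : Measure Ω}

theorem identDistrib_one_sub {U : Ω → ℝ} (hU : Measurable U)
    (hUP : P.map U = volume.restrict (Icc 0 1)) :
    IdentDistrib U (fun ω => 1 - U ω) P P := by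
  refine ⟨hU.aemeasurable, (hU.const_sub 1).aemeasurable, ?_⟩
  have h := ((volume : Measure ℝ).measurePreserving_sub_left 1).restrict_preimage
    (measurableSet_Icc (a := (0 : ℝ)) (b := 1))
  have e : (fun x : ℝ => 1 - x) ⁻¹' Icc 0 1 = Icc 0 1 := by
    simp
  rw [e] at h
  have : (fun ω => 1 - U ω) = (fun x : ℝ => 1 - x) ∘ U := rfl
  rw [this, ← Measure.map_map (by fun_prop) hU, hUP, h.map_eq]

/-- The random variable with centre `μ`, scale `c` and an atom of mass `1 - 2 p` at `μ`, built from
a uniform variable `U`. -/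
noncomputable def uniformWithAtom (U : Ω → ℝ) (μ c p : ℝ) (ω : Ω) : ℝ :=
  μ + c * uniformWithAtomQuantile p (U ω)

variable {U : Ω → ℝ} {μ c p : ℝ}

theorem distFun_uniformWithAtom_of_lt (hU : Measurable U)
    (hUP : P.map U = volume.restrict (Icc 0 1)) (hc : 0 < c) (hp0 : 0 < p) (hp : p ≤ 1 / 2) {x : ℝ}
    (hx : x < μ) :
    distFun P (uniformWithAtom U μ c p) x = max 0 (p + (x - μ) / c) := by
  have hz : (x - μ) / c < 0 := div_neg_of_neg_of_pos (by linarith) hc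
  have e : {ω | uniformWithAtom U μ c p ω ≤ x} = U ⁻¹' Iic (p + (x - μ) / c) := by
    ext ω
    simp only [uniformWithAtom, mem_ofPred_eq, mem_preimage, mem_Iic]
    rw [← uniformWithAtomQuantile_le_iff_of_neg hp hz, le_div_iff₀ hc, mul_comm,
      le_sub_iff_add_le']
  have e' : Iic (p + (x - μ) / c) ∩ Icc 0 1 = Icc 0 (p + (x - μ) / c) := by
    ext u
    simp only [mem_inter_iff, mem_Iic, mem_Icc]
    exact ⟨fun h => ⟨h.2.1, h.1⟩, fun h => ⟨h.2, h.1, by linarith [h.2]⟩⟩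
  rw [distFun, e, ← map_measureReal_apply hU measurableSet_Iic, hUP,
    measureReal_restrict_apply measurableSet_Iic, e', Real.volume_real_Icc, sub_zero, max_comm]

theorem distFun_uniformWithAtom_of_le (hU : Measurable U)
    (hUP : P.map U = volume.restrict (Icc 0 1)) (hc : 0 < c) (hp0 : 0 < p) (hp : p ≤ 1 / 2) {x : ℝ}
    (hx : μ ≤ x) :
    distFun P (uniformWithAtom U μ c p) x = min 1 (1 - p + (x - μ) / c) := by
  have hz : 0 ≤ (x - μ) / c := div_nonneg (by linarith) hc.le
  have e : {ω | uniformWithAtom U μ c p ω ≤ x} = U ⁻¹' Iic (1 - p + (x - μ) / c) := by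
    ext ω
    simp only [uniformWithAtom, mem_ofPred_eq, mem_preimage, mem_Iic]
    rw [← uniformWithAtomQuantile_le_iff_of_nonneg hp hz, le_div_iff₀ hc, mul_comm,
      le_sub_iff_add_le']
  have e' : Iic (1 - p + (x - μ) / c) ∩ Icc 0 1 = Icc 0 (min 1 (1 - p + (x - μ) / c)) := by
    ext u
    simp only [mem_inter_iff, mem_Iic, mem_Icc, le_min_iff]
    tauto
  have h0 : 0 ≤ min 1 (1 - p + (x - μ) / c) := le_min zero_le_one (by linarith)
  rw [distFun, e, ← map_measureReal_apply hU measurableSet_Iic, hUP,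
    measureReal_restrict_apply measurableSet_Iic, e', Real.volume_real_Icc, sub_zero,
    max_eq_left h0]

theorem uniformWithAtom_mem_symmUnimodal [IsProbabilityMeasure P] (hU : Measurable U)
    (hUP : P.map U = volume.restrict (Icc 0 1)) (hc : 0 < c) (hp0 : 0 < p) (hp : p ≤ 1 / 2) {σ : ℝ}
    (hσ : c ^ 2 * (2 / 3 * p ^ 3) = σ ^ 2) :
    uniformWithAtom U μ c p ∈ symmUnimodal P μ σ := by
  have hqc := continuous_uniformWithAtomQuantile p
  have hm : Measurable (uniformWithAtom U μ c p) := by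
    unfold uniformWithAtom
    exact ((hqc.measurable.comp hU).const_mul c).const_add μ
  have hsq : Integrable (fun ω => uniformWithAtomQuantile p (U ω) ^ 2) P := by
    have h : Integrable (fun u => uniformWithAtomQuantile p u ^ 2) (P.map U) := by
      rw [hUP]
      exact (hqc.pow 2).integrableOn_Icc
    exact h.comp_measurable hU
  have hq2 : MemLp (fun ω => uniformWithAtomQuantile p (U ω)) 2 P :=
    (memLp_two_iff_integrable_sq (hqc.measurable.comp hU).aestronglyMeasurable).2 hsq
  have hL : MemLp (uniformWithAtom U μ c p) 2 P := (memLp_const μ).add (hq2.const_mul c)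
  have hXi : Integrable (uniformWithAtom U μ c p) P := hL.integrable (by norm_num)
  have hsym : IdentDistrib (fun ω => uniformWithAtom U μ c p ω - μ)
      (fun ω => μ - uniformWithAtom U μ c p ω) P P := by
    have := (identDistrib_one_sub hU hUP).comp (u := fun u => c * uniformWithAtomQuantile p u)
      (hqc.measurable.const_mul c)
    convert! this using 1
    · ext ω
      simp [uniformWithAtom]
    · ext ω
      simp [uniformWithAtom, uniformWithAtomQuantile_one_sub]
  have hmean : P[uniformWithAtom U μ c p] = μ := by
    have := hsym.integral_eq
    rw [integral_sub hXi (integrable_const μ), integral_sub (integrable_const μ) hXi] at this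
    simp only [integral_const, probReal_univ, smul_eq_mul, one_mul] at this
    linarith
  refine ⟨hm, hL, hmean, ?_, ⟨μ, hsym⟩, μ, ?_, ?_⟩
  · rw [variance_eq_integral hm.aemeasurable, hmean, ← hσ,
      ← integral_uniformWithAtomQuantile_sq hp0.le hp, intervalIntegral.integral_of_le zero_le_one,
      ← integral_Icc_eq_integral_Ioc, ← hUP,
      integral_map (f := fun u => uniformWithAtomQuantile p u ^ 2) hU.aemeasurable (by fun_prop),
      ← integral_const_mul]
    refine integral_congr_ae (ae_of_all _ fun ω => ?_)
    simp only [uniformWithAtom]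
    ring
  · have h : ConvexOn ℝ (Iio μ) fun x => max 0 (p + (x - μ) / c) := by
      refine (convexOn_const 0 (convex_Iio μ)).sup ?_
      refine ⟨convex_Iio μ, fun x _ y _ a b _ _ hab => le_of_eq ?_⟩
      simp only [smul_eq_mul]
      field_simp
      linear_combination (μ - p * c) * hab
    exact h.congr fun x hx => (distFun_uniformWithAtom_of_lt hU hUP hc hp0 hp hx).symm
  · have h : ConcaveOn ℝ (Ioi μ) fun x => min 1 (1 - p + (x - μ) / c) := by
      refine (concaveOn_const 1 (convex_Ioi μ)).inf ?_
      refine ⟨convex_Ioi μ, fun x _ y _ a b _ _ hab => le_of_eq ?_⟩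
      simp only [smul_eq_mul]
      field_simp
      linear_combination (c - μ - p * c) * hab
    exact h.congr fun x hx => (distFun_uniformWithAtom_of_le hU hUP hc hp0 hp (le_of_lt hx)).symm

theorem entropy_of_integrable {g : ℝ → ℝ} {X : Ω → ℝ}
    (hi : Integrable fun x => g (survFun P X x)) :
    EntropyWellDefined P g X ∧ entropy P g X = ((∫ x, g (survFun P X x) : ℝ) : EReal) := by
  have h1 : entropyPos P g X ≠ ⊤ := hi.lintegral_lt_top.ne
  have h2 : entropyNeg P g X ≠ ⊤ := hi.neg.lintegral_lt_top.ne
  refine ⟨Or.inl h1, ?_⟩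
  rw [integral_eq_lintegral_pos_part_sub_lintegral_neg_part hi, EReal.coe_sub]
  exact congrArg₂ _ (EReal.coe_ennreal_toReal h1).symm (EReal.coe_ennreal_toReal h2).symm

theorem measurable_comp_survFun [IsProbabilityMeasure P] {g : ℝ → ℝ}
    (hg : BoundedVariationOn g (Icc 0 1)) (X : Ω → ℝ) :
    Measurable fun x => g (survFun P X x) := by
  obtain ⟨p, q, hp, hq, rfl⟩ := hg.locallyBoundedVariationOn.exists_monotoneOn_sub_monotoneOn
  have hS : ∀ x, survFun P X x ∈ Icc (0 : ℝ) 1 := fun x => ⟨measureReal_nonneg, measureReal_le_one⟩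
  have hanti : Antitone (survFun P X) := fun x y hxy =>
    measureReal_mono fun ω hω => lt_of_le_of_lt hxy hω
  have h1 : Antitone fun x => p (survFun P X x) := fun x y hxy => hp (hS y) (hS x) (hanti hxy)
  have h2 : Antitone fun x => q (survFun P X x) := fun x y hxy => hq (hS y) (hS x) (hanti hxy)
  exact h1.measurable.sub h2.measurable

theorem integral_comp_survFun_uniformWithAtom [IsProbabilityMeasure P] {g : ℝ → ℝ}
    (hg : BoundedVariationOn g (Icc 0 1))
    (hg0 : g 0 = 0) (hg1 : g 1 = 0) (hU : Measurable U)
    (hUP : P.map U = volume.restrict (Icc 0 1)) (hc : 0 < c) (hp0 : 0 < p) (hp : p ≤ 1 / 2)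
    (hm : Measurable (uniformWithAtom U μ c p)) :
    Integrable (fun x => g (survFun P (uniformWithAtom U μ c p) x)) ∧
      ∫ x, g (survFun P (uniformWithAtom U μ c p) x)
        = c * ((∫ u in (0 : ℝ)..p, g u) + ∫ u in (1 - p)..1, g u) := by
  set G := fun x => g (survFun P (uniformWithAtom U μ c p) x) with hG
  have hlt : ∀ x, x < μ → G x = g (1 - max 0 (p + (x - μ) / c)) := fun x hx => by
    rw [hG]
    simp only [survFun_eq hm, distFun_uniformWithAtom_of_lt hU hUP hc hp0 hp hx]
  have hle : ∀ x, μ ≤ x → G x = g (1 - min 1 (1 - p + (x - μ) / c)) := fun x hx => by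
    rw [hG]
    simp only [survFun_eq hm, distFun_uniformWithAtom_of_le hU hUP hc hp0 hp hx]
  have hcp : 0 < c * p := mul_pos hc hp0
  have hout : ∀ x, x ∉ Ioc (μ - c * p) (μ + c * p) → G x = 0 := by
    intro x hx
    rcases lt_or_ge x μ with h | h
    · have h' : x ≤ μ - c * p := by
        by_contra h'
        exact hx ⟨not_le.1 h', by linarith⟩
      have : (x - μ) / c ≤ -p := by
        rw [div_le_iff₀ hc]
        linarith
      rw [hlt x h, max_eq_left (by linarith), sub_zero, hg1]
    · have h' : μ + c * p < x := by
        by_contra h'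
        exact hx ⟨by linarith, not_lt.1 h'⟩
      have : p ≤ (x - μ) / c := by
        rw [le_div_iff₀ hc]
        linarith
      rw [hle x h, min_eq_left (by linarith), sub_self, hg0]
  obtain ⟨M, _, hM⟩ := hg.exists_abs_le
  have hi : Integrable G := by
    have : IntegrableOn G (Ioc (μ - c * p) (μ + c * p)) :=
      Measure.integrableOn_of_bounded (by simp)
        (measurable_comp_survFun hg _).aestronglyMeasurable (M := M)
        (ae_of_all _ fun x => hM _ ⟨measureReal_nonneg, measureReal_le_one⟩)
    rw [← integrable_indicator_iff measurableSet_Ioc] at this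
    convert! this using 1
    ext x
    by_cases hx : x ∈ Ioc (μ - c * p) (μ + c * p)
    · rw [indicator_of_mem hx]
    · rw [indicator_of_notMem hx, hout x hx]
  refine ⟨hi, ?_⟩
  have e1 : ∫ x in (μ - c * p)..μ, G x = c * ∫ u in (1 - p)..1, g u := by
    rw [intervalIntegral.integral_congr_ae (g := fun x => g (1 - p + μ / c - x / c)) ?_,
      intervalIntegral.integral_comp_sub_div g hc.ne', smul_eq_mul]
    · congr 2 <;> field_simp <;> ring
    · filter_upwards [(countable_singleton μ).ae_notMem volume] with x hxμ hx
      rw [uIoc_of_le (by linarith)] at hx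
      have : -p ≤ (x - μ) / c := by
        rw [le_div_iff₀ hc]
        linarith [hx.1]
      rw [hlt x (lt_of_le_of_ne hx.2 hxμ), max_eq_right (by linarith)]
      congr 1
      ring
  have e2 : ∫ x in μ..(μ + c * p), G x = c * ∫ u in (0 : ℝ)..p, g u := by
    rw [intervalIntegral.integral_congr (g := fun x => g (p + μ / c - x / c)) fun x hx => ?_,
      intervalIntegral.integral_comp_sub_div g hc.ne', smul_eq_mul]
    · congr 2 <;> field_simp <;> ring
    · rw [uIcc_of_le (by linarith)] at hx
      have : (x - μ) / c ≤ p := by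
        rw [div_le_iff₀ hc]
        linarith [hx.2]
      rw [hle x hx.1, min_eq_right (by linarith)]
      simp only
      congr 1
      ring
  rw [← setIntegral_eq_integral_of_forall_compl_eq_zero hout,
    ← intervalIntegral.integral_of_le (by linarith),
    ← intervalIntegral.integral_add_adjacent_intervals (b := μ) hi.intervalIntegrable
      hi.intervalIntegrable, e1, e2]
  ring

theorem const_mem_symmUnimodal [IsProbabilityMeasure P] (μ : ℝ) :
    (fun _ => μ) ∈ symmUnimodal P μ 0 := by
  refine ⟨measurable_const, memLp_const μ, by simp, by simp [variance_eq_integral],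
    ⟨μ, ?_⟩, μ, ?_, ?_⟩
  · exact IdentDistrib.refl (by fun_prop)
  · refine (convexOn_const (0 : ℝ) (convex_Iio μ)).congr fun x hx => ?_
    simp [distFun, not_le.2 (show x < μ from hx)]
  · refine (concaveOn_const (1 : ℝ) (convex_Ioi μ)).congr fun x hx => ?_
    simp [distFun, le_of_lt (show μ < x from hx)]

theorem worstCaseEntropy_zero_nonneg [IsProbabilityMeasure P] {g : ℝ → ℝ} (hg0 : g 0 = 0)
    (hg1 : g 1 = 0) (μ : ℝ) : 0 ≤ worstCaseEntropy P g μ 0 := by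
  have h0 : ∀ x, g (survFun P (fun _ : Ω => μ) x) = 0 := fun x => by
    by_cases h : x < μ <;> simp [survFun, h, hg0, hg1]
  obtain ⟨h1, h2⟩ := entropy_of_integrable (P := P) (g := g) (X := fun _ => μ) (by simp [h0])
  have : entropy P g (fun _ : Ω => μ) = 0 := by rw [h2]; simp [h0]
  rw [← this]
  exact le_iSup₂_of_le (fun _ => μ) ⟨const_mem_symmUnimodal μ, h1⟩ le_rfl

theorem mul_upsilon_le_worstCaseEntropy [IsProbabilityMeasure P] (hP : IsAtomless P) {g : ℝ → ℝ}
    (hg : BoundedVariationOn g (Icc 0 1)) (hg0 : g 0 = 0) (hg1 : g 1 = 0) (μ : ℝ) {σ : ℝ}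
    (hσ : 0 < σ) {b : ℝ} (hb : b ∈ Ico (1 / 2 : ℝ) 1) :
    ((σ * upsilon (hat g) b : ℝ) : EReal) ≤ worstCaseEntropy P g μ σ := by
  obtain ⟨U, hU, hUP⟩ := hP.exists_uniform
  have hp0 : 0 < 1 - b := by linarith [hb.2]
  have hp : 1 - b ≤ 1 / 2 := by linarith [hb.1]
  have hs : 0 < 2 / 3 * (1 - b) ^ 3 := by positivity
  have hs' := Real.sqrt_pos.2 hs
  have hc : 0 < σ / √(2 / 3 * (1 - b) ^ 3) := div_pos hσ hs'
  have hX := uniformWithAtom_mem_symmUnimodal (μ := μ) hU hUP hc hp0 hp (σ := σ) (by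
    rw [div_pow, Real.sq_sqrt hs.le]
    field_simp)
  obtain ⟨hi, he⟩ := integral_comp_survFun_uniformWithAtom hg hg0 hg1 hU hUP hc hp0 hp hX.1
  obtain ⟨h1, h2⟩ := entropy_of_integrable hi
  refine le_trans (le_of_eq ?_) (le_iSup₂_of_le _ ⟨hX, h1⟩ le_rfl)
  rw [h2, he, upsilon_hat hg hg0 hb, sub_sub_cancel]
  congr 1
  ring

end

theorem corollary3 {Ω : Type*} [MeasurableSpace Ω] (P : Measure Ω) [IsProbabilityMeasure P]
    (hP : IsAtomless P) (g : ℝ → ℝ) (hg : BoundedVariationOn g (Icc 0 1)) (hg0 : g 0 = 0)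
    (hg1 : g 1 = 0) (μ σ : ℝ) (hσ : 0 ≤ σ) :
    (σ : EReal) * (⨆ b ∈ Ico (1 / 2 : ℝ) 1, (upsilon (hat g) b : EReal))
        ≤ worstCaseEntropy P g μ σ ∧
      (ContinuousOn (convexEnvelope (hat g)) (Icc 0 1) →
        worstCaseEntropy P g μ σ ≤ (σ : EReal) * (bigDelta (hat g) : EReal)) := by
  refine ⟨?_, worstCaseEntropy_le hg hg0 hg1 hσ⟩
  rcases hσ.eq_or_lt with rfl | hσ
  · rw [EReal.coe_zero, zero_mul]
    exact worstCaseEntropy_zero_nonneg hg0 hg1 μ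
  · have hσ' : (0 : EReal) < σ := EReal.coe_pos.2 hσ
    rw [mul_comm, ← EReal.le_div_iff_mul_le hσ' (EReal.coe_ne_top σ)]
    refine iSup₂_le fun b hb => ?_
    rw [EReal.le_div_iff_mul_le hσ' (EReal.coe_ne_top σ), ← EReal.coe_mul, mul_comm]
    exact mul_upsilon_le_worstCaseEntropy hP hg hg0 hg1 μ hσ hb
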